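/- A strict partition is a finite strictly decreasing sequence $\lambda=(\lambda_1>\lambda_2>\dots>\lambda_\ell)$ of positive integers (possibly empty). Write $|\lambda|=\sum_i\lambda_i$, $\ell(\lambda)=\ell$, and $\lambda_i=0$ for $i>\ell$. Its shifted Young diagram is the set of boxes $(i,j)$ with $1\le i\le\ell$ and $i+1\le j\le i+\lambda_i$. The content of $\square=(i,j)$ is $c_\square=j-i$; its hook length is the number of boxes of the diagram exactly to its right, plus the number exactly below it, plus $1$, plus $\lambda_j$. Let $H_\lambda$ be the product of all hook lengths of $\lambda$. Write $\lambda\supseteq\mu$ if $\lambda_i\ge\mu_i$ for all $i$; in this case $\lambda/\mu$ denotes the set of boxes of $\lambda$ that are not in $\mu$, $|\lambda/\mu|=|\lambda|-|\mu|$, and $f_{\lambda/\mu}$ is the number of standard shifted Young tableaux of shape $\lambda/\mu$, i.e. of bijective fillings of these boxes with $1,\dots,|\lambda/\mu|$ that increase along rows and down columns. Theorem. Let $K$ be a field of characteristic zero, let $Q$ be a symmetric function over $K$ (a formal power series of bounded degree in countably many variables, invariant under all permutations of the variables), and let $\mu$ be a strict partition. Then $$P(n)=\sum_{|\lambda/\mu|=n}\frac{2^{|\lambda|-|\mu|-\ell(\lambda)+\ell(\mu)}\,f_{\lambda/\mu}}{H_\lambda}\;Q\Bigl(\tbinom{c_\square}{2}:\square\in\lambda\Bigr)$$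 is a polynomial in $n$ with coefficients in $K$, i.e. agrees with one for all integers $n\ge0$. Here the sum is over all strict partitions $\lambda\supseteq\mu$ with $|\lambda/\mu|=n$, and $Q(\binom{c_\square}{2}:\square\in\lambda)$ means that $|\lambda|$ of the variables are substituted by the values $\binom{c_\square}{2}$, $\square\in\lambda$, and all other variables by $0$. -/

import Mathlib

/-- A strict partition: a finite strictly decreasing sequence of positive integers. -/
@[ext]
structure StrictPartition where
  parts : List ℕ
  strictAnti : parts.Pairwise (fun a b => b < a)
  pos : ∀ a ∈ parts, 0 < a

namespace StrictPartition

/-- The size `|lam|`, the sum of the parts. -/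
def size (lam : StrictPartition) : ℕ := lam.parts.sum

/-- The length `ℓ(lam)`, the number of parts. -/
def length (lam : StrictPartition) : ℕ := lam.parts.length

/-- The `i`-th part, counted from `i = 0`, with value `0` beyond the length. -/
def part (lam : StrictPartition) (i : ℕ) : ℕ := lam.parts.getD i 0

/-- `lam.Contains mu` means `lam ⊇ mu`. -/
def Contains (lam mu : StrictPartition) : Prop := ∀ i, mu.part i ≤ lam.part i

/-- The shifted Young diagram. Rows and columns are both counted from `0`, so that row `i`
consists of the boxes `(i, j)` with `i + 1 ≤ j ≤ i + lam_i`. -/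
def cells (lam : StrictPartition) : Finset (ℕ × ℕ) :=
  (Finset.range lam.length).biUnion fun i =>
    (Finset.Icc (i + 1) (i + lam.part i)).image fun j => (i, j)

theorem mem_cells (lam : StrictPartition) (b : ℕ × ℕ) :
    b ∈ lam.cells ↔ b.1 < b.2 ∧ b.2 ≤ b.1 + lam.part b.1 := by
  obtain ⟨i, j⟩ := b
  simp only [cells, Finset.mem_biUnion, Finset.mem_range, Finset.mem_image, Finset.mem_Icc,
    Prod.mk.injEq]
  constructor
  · rintro ⟨a, -, c, hc, rfl, rfl⟩
    exact ⟨by omega, hc.2⟩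
  · rintro ⟨h1, h2⟩
    refine ⟨i, ?_, j, ⟨by omega, h2⟩, rfl, rfl⟩
    by_contra h
    have h0 : lam.part i = 0 := by
      unfold part length at *
      exact List.getD_eq_default _ _ (by omega)
    omega

/-- The content `j - i` of the box `(i, j)`; it is positive on shifted diagrams. -/
def content (b : ℕ × ℕ) : ℕ := b.2 - b.1

/-- The hook length of a box `(i, j)`: the number of boxes exactly to its right, plus the number
of boxes exactly below it, plus one for the box itself, plus `lam_j`. -/
def hookLength (lam : StrictPartition) (b : ℕ × ℕ) : ℕ :=
  (lam.cells.filter fun c => c.1 = b.1 ∧ b.2 < c.2).card +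
    (lam.cells.filter fun c => c.2 = b.2 ∧ b.1 < c.1).card + 1 + lam.part b.2

/-- `H_lam`, the product of all hook lengths. -/
def hookProduct (lam : StrictPartition) : ℕ := ∏ b ∈ lam.cells, lam.hookLength b

/-- The boxes of the skew shifted diagram `lam/mu`. -/
def skewCells (lam mu : StrictPartition) : Finset (ℕ × ℕ) := lam.cells \ mu.cells

/-- Standard shifted Young tableaux of shape `lam/mu`: bijective fillings of the boxes by
`0, …, n - 1`, where `n` is the number of boxes, increasing along rows and down columns. -/
structure StandardTableau (lam mu : StrictPartition) where
  entry : {b : ℕ × ℕ // b ∈ skewCells lam mu} ≃ Fin (skewCells lam mu).card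
  row_lt : ∀ b c, b.1.1 = c.1.1 → b.1.2 < c.1.2 → entry b < entry c
  col_lt : ∀ b c, b.1.2 = c.1.2 → b.1.1 < c.1.1 → entry b < entry c

/-- `f_{lam/mu}`, the number of standard shifted Young tableaux of shape `lam/mu`. -/
noncomputable def numTableaux (lam mu : StrictPartition) : ℕ := Nat.card (StandardTableau lam mu)

theorem finite_size_eq (k : ℕ) : {lam : StrictPartition | lam.size = k}.Finite := by
  let F : {lam : StrictPartition // lam.size = k} → Nat.Partition k := fun lam =>
    ⟨(lam.1.parts : Multiset ℕ), fun {i} hi => lam.1.pos i (by simpa using hi),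
      by simpa [size] using lam.2⟩
  have hF : Function.Injective F := by
    rintro ⟨a, ha⟩ ⟨b, hb⟩ hab
    have h : (a.parts : Multiset ℕ) = b.parts := congrArg Nat.Partition.parts hab
    have hp : a.parts.Perm b.parts := Multiset.coe_eq_coe.1 h
    have he : a.parts = b.parts :=
      hp.eq_of_pairwise (fun x y _ _ h1 h2 => absurd h1 (by omega)) a.strictAnti b.strictAnti
    exact Subtype.ext (StrictPartition.ext he)
  exact @Set.toFinite _ _ (Finite.of_injective F hF)

/-- The finite set of strict partitions `lam ⊇ mu` with `|lam/mu| = n`. -/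
noncomputable def skewOfSize (mu : StrictPartition) (n : ℕ) : Finset StrictPartition :=
  ((finite_size_eq (mu.size + n)).subset
    (fun _ h => h.2 : {lam : StrictPartition | lam.Contains mu ∧ lam.size = mu.size + n} ⊆
      {lam | lam.size = mu.size + n})).toFinset

theorem mem_skewOfSize (lam mu : StrictPartition) (n : ℕ) :
    lam ∈ mu.skewOfSize n ↔ lam.Contains mu ∧ lam.size = mu.size + n := by
  simp [skewOfSize]

end StrictPartition

/-- `Q` is a symmetric function in the variables `x_0, x_1, x_2, …`: a formal power series of
bounded degree that is invariant under every permutation of the variables. -/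
structure IsSymmetricFunction {K : Type*} [Field K] (Q : MvPowerSeries ℕ K) : Prop where
  bounded : ∃ d : ℕ, ∀ m : ℕ →₀ ℕ, d < m.degree → MvPowerSeries.coeff m Q = 0
  symm : ∀ (σ : Equiv.Perm ℕ) (m : ℕ →₀ ℕ),
    MvPowerSeries.coeff (m.equivMapDomain σ) Q = MvPowerSeries.coeff m Q

namespace IsSymmetricFunction

variable {K : Type*} [Field K]

/-- The value of `Q` at `x_i = a i`. The sum has only finitely many nonzero terms if `Q` has
bounded degree and all but finitely many `a i` vanish, see `finite_support_term`. -/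
noncomputable def evalSeq (Q : MvPowerSeries ℕ K) (a : ℕ → K) : K :=
  ∑ᶠ m : ℕ →₀ ℕ, MvPowerSeries.coeff m Q * m.prod fun i e => a i ^ e

/-- The value of `Q` when `#s` of the variables are substituted by the `v b` with `b ∈ s`, and all
other variables by `0`. The choice of the `#s` variables is irrelevant if `Q` is symmetric, see
`evalOn_eq`. -/
noncomputable def evalOn {ι : Type*} (Q : MvPowerSeries ℕ K) (s : Finset ι) (v : ι → K) : K :=
  evalSeq Q fun i => if h : i < s.card then v (s.equivFin.symm ⟨i, h⟩) else 0

theorem finite_support_term {Q : MvPowerSeries ℕ K} (hQ : IsSymmetricFunction Q) (a : ℕ → K)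
    (ha : (Function.support a).Finite) :
    (Function.support fun m : ℕ →₀ ℕ =>
      MvPowerSeries.coeff m Q * m.prod fun i e => a i ^ e).Finite := by
  obtain ⟨d, hd⟩ := hQ.bounded
  refine (Set.finite_Iic (ha.toFinset.sum fun i => Finsupp.single i d)).subset fun m hm i => ?_
  have hc : MvPowerSeries.coeff m Q ≠ 0 := left_ne_zero_of_mul hm
  have hp : (m.prod fun i e => a i ^ e) ≠ 0 := right_ne_zero_of_mul hm
  have hdeg : m.degree ≤ d := not_lt.1 fun h => hc (hd m h)
  by_cases hi : m i = 0
  · rw [hi]; exact Nat.zero_le _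
  have hai : a i ≠ 0 := by
    intro h0
    exact hp (Finset.prod_eq_zero (Finsupp.mem_support_iff.2 hi) (by simp [h0, hi]))
  have hmem : i ∈ ha.toFinset := by simpa using hai
  calc m i ≤ m.degree := Finsupp.le_degree i m
    _ ≤ d := hdeg
    _ = (Finsupp.single i d) i := by simp
    _ ≤ ∑ k ∈ ha.toFinset, (Finsupp.single k d) i :=
        Finset.single_le_sum (f := fun k => (Finsupp.single k d : ℕ →₀ ℕ) i)
          (fun _ _ => Nat.zero_le _) hmem
    _ = _ := by rw [Finsupp.finsetSum_apply]

theorem evalSeq_perm {Q : MvPowerSeries ℕ K} (hQ : IsSymmetricFunction Q) (a : ℕ → K)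
    (σ : Equiv.Perm ℕ) : evalSeq Q (fun i => a (σ i)) = evalSeq Q a := by
  unfold evalSeq
  rw [← finsum_comp_equiv (Finsupp.equivCongrLeft (M := ℕ) σ)
    (f := fun m : ℕ →₀ ℕ => MvPowerSeries.coeff m Q * m.prod fun i e => a i ^ e)]
  refine finsum_congr fun m => ?_
  rw [Finsupp.equivCongrLeft_apply, hQ.symm, Finsupp.equivMapDomain_eq_mapDomain,
    Finsupp.prod_mapDomain_index_inj σ.injective]

theorem evalOn_eq {ι : Type*} {Q : MvPowerSeries ℕ K} (hQ : IsSymmetricFunction Q) (s : Finset ι)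
    (v : ι → K) (e : {b // b ∈ s} ↪ ℕ) :
    evalOn Q s v = evalSeq Q (Function.extend e (fun b => v b) 0) := by
  let p : {b // b ∈ s} ↪ ℕ := s.equivFin.toEmbedding.trans Fin.valEmbedding
  obtain ⟨σ, hσ⟩ : ∃ σ : Equiv.Perm ℕ, ∀ b, σ (p b) = e b := by
    classical
    have hp : Infinite ↑(Set.range p)ᶜ := (Set.finite_range p).infinite_compl.to_subtype
    have he : Infinite ↑(Set.range e)ᶜ := (Set.finite_range e).infinite_compl.to_subtype
    obtain ⟨u⟩ := nonempty_equiv_of_countable (α := ↑(Set.range p)ᶜ) (β := ↑(Set.range e)ᶜ)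
    let w := (Equiv.ofInjective p p.injective).symm.trans (Equiv.ofInjective e e.injective)
    refine ⟨(Equiv.Set.sumCompl (Set.range p)).symm.trans
      ((Equiv.sumCongr w u).trans (Equiv.Set.sumCompl (Set.range e))), fun b => ?_⟩
    have hb : (Equiv.ofInjective p p.injective).symm ⟨p b, ⟨b, rfl⟩⟩ = b :=
      Equiv.ofInjective_symm_apply p.injective b
    simp [w, Equiv.Set.sumCompl_symm_apply_of_mem, hb]
  rw [evalOn, ← evalSeq_perm hQ (Function.extend e (fun b => v b) 0) σ]
  congr 1
  funext i
  by_cases h : i < s.card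
  · have hi : p (s.equivFin.symm ⟨i, h⟩) = i := by simp [p]
    rw [dif_pos h]
    conv_rhs => rw [← hi, hσ, e.injective.extend_apply]
  · rw [dif_neg h, Function.extend_apply']
    · rfl
    · rintro ⟨b, hb⟩
      rw [← hσ b] at hb
      exact h (σ.injective hb ▸ (s.equivFin b).2)

end IsSymmetricFunction

/-! For a function `F` on strict partitions let W_n(F) be the sum of 2^(|λ|-|μ|-ℓ(λ)+ℓ(μ)) f_{λ/μ}
F(λ) / H_λ over all λ ⊇ μ with |λ/μ| = n. The largest entry of a tableau sits in a removable box, so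
f_{λ/μ} is the sum of f_{κ/μ} over the κ obtained by removing one box from λ (`numTableaux_succ`).
Hence W_{n+1}(F) = W_n(F) + W_n(DF), where DF(κ) is the average of F(λ) - F(κ) over all ways to add
a box, with weights 2^(1-ℓ(λ)+ℓ(κ)) H_κ / H_λ, provided that these weights sum to 1. It remains to
see that some power of D kills λ ↦ Q(binom(c_□, 2)); Newton interpolation then yields a polynomial.

Adding a box replaces an element a of S ∪ {0} by a + 1, where S is the set of parts of κ. By the
product formula H = ∏ λ_i! ∏_{i<j} (λ_i + λ_j)/(λ_i - λ_j), the weight of this move is a Lagrange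
coefficient: with p(a) = a(a+1) it is ∏_{b∈S} (p(a) - b(b-1)) / ∏_{b≠a} (p(a) - p(b)), the second
product over S ∪ {0} (`hookValue_move`). So the moments m_k = ∑ weight · p(a)^k have the generating
function ∏_{b∈S} (1 - b(b-1)X) / (1 - p(b)X) (`mk_moment_mul_prod`). In particular m_0 = 1, and a
move changes this function by an explicit rational factor in p(a) alone.

Degrees are counted by `PolyDeg`: `F` has degree at most n if its increments are sums of terms
p(a)^e c(κ) with deg c + e < n. Averaging turns p(a)^e into m_e, and m_e has degree at most e
(`polyDeg_moment`), so D lowers positive degrees by at least one and kills degree 0. A box added to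
a part a has binom(c, 2) = p(a)/2, so expanding `Q` in one variable shows by induction that
evaluating a symmetric function of degree at most d gives degree at most 2d (`polyDeg_evalOn`). -/

namespace StrictPartition

/-! ### Adding a box, in terms of rows and of the set of parts -/

theorem part_pos_iff (lam : StrictPartition) (i : ℕ) : 0 < lam.part i ↔ i < lam.length := by
  constructor
  · intro h
    by_contra hi
    rw [part, List.getD_eq_default _ _ (by unfold length at hi; omega)] at h
    exact absurd h (lt_irrefl _)
  · intro h
    rw [part, List.getD_eq_getElem _ _ h]
    exact lam.pos _ (List.getElem_mem h)

theorem part_eq_zero_iff (lam : StrictPartition) (i : ℕ) : lam.part i = 0 ↔ lam.length ≤ i := by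
  rw [← not_lt, ← part_pos_iff, not_lt, Nat.le_zero]

theorem part_lt_part (lam : StrictPartition) {i j : ℕ} (hij : i < j) (hi : 0 < lam.part i) :
    lam.part j < lam.part i := by
  by_cases hj : j < lam.length
  · have hi' := (lam.part_pos_iff i).1 hi
    rw [part, part, List.getD_eq_getElem _ _ hi', List.getD_eq_getElem _ _ hj]
    exact List.pairwise_iff_getElem.1 lam.strictAnti i j hi' hj hij
  · rw [(lam.part_eq_zero_iff j).2 (by omega)]
    exact hi

theorem part_injOn_pos (lam : StrictPartition) {i j : ℕ} (hi : 0 < lam.part i)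
    (h : lam.part i = lam.part j) : i = j := by
  rcases lt_trichotomy i j with hij | hij | hij
  · have := lam.part_lt_part hij hi
    omega
  · exact hij
  · have := lam.part_lt_part hij (h ▸ hi)
    omega

theorem eq_of_part_eq {lam kap : StrictPartition} (h : lam.part = kap.part) : lam = kap := by
  have hl : lam.length = kap.length := by
    have := fun i => (lam.part_pos_iff i).symm.trans (h ▸ kap.part_pos_iff i)
    have h1 := this lam.length
    have h2 := this kap.length
    omega
  apply StrictPartition.ext
  refine List.ext_getElem hl fun i h1 h2 => ?_
  have := congrFun h i
  rwa [part, part, List.getD_eq_getElem _ _ h1, List.getD_eq_getElem _ _ h2] at this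

theorem exists_part_eq (p : ℕ → ℕ) (hp : ∀ i, 0 < p (i + 1) → p (i + 1) < p i)
    (h0 : ∃ N, p N = 0) : ∃ lam : StrictPartition, lam.part = p := by
  classical
  have hpos : ∀ i < Nat.find h0, 0 < p i := fun i hi => Nat.pos_of_ne_zero (Nat.find_min h0 hi)
  have hzero : ∀ i, Nat.find h0 ≤ i → p i = 0 := by
    intro i hi
    induction i, hi using Nat.le_induction with
    | base => exact Nat.find_spec h0
    | succ k hk ih =>
      by_contra h
      have := hp k (Nat.pos_of_ne_zero h)
      omega
  have hlt : ∀ i j, i < j → 0 < p j → p j < p i := by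
    intro i j hij
    induction j, hij using Nat.le_induction with
    | base => exact hp i
    | succ k hk ih =>
      intro h
      have := hp k h
      have := ih (by omega)
      omega
  refine ⟨⟨(List.range (Nat.find h0)).map p, ?_, ?_⟩, ?_⟩
  · rw [List.pairwise_iff_getElem]
    intro i j hi hj hij
    simp only [List.length_map, List.length_range] at hi hj
    simpa using hlt i j hij (hpos j hj)
  · intro a ha
    obtain ⟨i, hi, rfl⟩ := List.mem_map.1 ha
    exact hpos i (List.mem_range.1 hi)
  · funext i
    by_cases hi : i < Nat.find h0
    · rw [part, List.getD_eq_getElem _ _ (by simpa using hi)]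
      simp
    · rw [part, List.getD_eq_default _ _ (by simpa using hi), hzero i (by omega)]

theorem size_eq_sum_range (lam : StrictPartition) {L : ℕ} (hL : lam.length ≤ L) :
    lam.size = ∑ i ∈ Finset.range L, lam.part i := by
  rw [← Finset.sum_subset (Finset.range_subset_range.2 hL)
    (fun i _ hi => (lam.part_eq_zero_iff i).2 (by simpa using hi)), Finset.sum_range, size,
    ← Fin.sum_univ_getElem]
  exact Finset.sum_congr rfl fun i _ => by
    rw [part, List.getD_eq_getElem _ _ i.2]

/-- `lam` arises from `kap` by adding a box to row `r`. -/
def Step (kap lam : StrictPartition) (r : ℕ) : Prop :=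
  lam.part = Function.update kap.part r (kap.part r + 1)

theorem Step.part_self {kap lam : StrictPartition} {r : ℕ} (h : Step kap lam r) :
    lam.part r = kap.part r + 1 := by rw [h, Function.update_self]

theorem Step.part_of_ne {kap lam : StrictPartition} {r i : ℕ} (h : Step kap lam r) (hi : i ≠ r) :
    lam.part i = kap.part i := by rw [h, Function.update_of_ne hi]

theorem Contains.trans {lam kap mu : StrictPartition} (h : lam.Contains kap)
    (h' : kap.Contains mu) : lam.Contains mu := fun i => (h' i).trans (h i)

theorem Step.contains {kap lam : StrictPartition} {r : ℕ} (h : Step kap lam r) :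
    lam.Contains kap := by
  intro i
  by_cases hi : i = r
  · rw [hi, h.part_self]
    omega
  · rw [h.part_of_ne hi]

theorem Step.size_eq {kap lam : StrictPartition} {r : ℕ} (h : Step kap lam r) :
    lam.size = kap.size + 1 := by
  have hr : r < kap.length + lam.length + (r + 1) := by omega
  rw [lam.size_eq_sum_range (L := kap.length + lam.length + (r + 1)) (by omega),
    kap.size_eq_sum_range (L := kap.length + lam.length + (r + 1)) (by omega), h,
    Finset.sum_update_of_mem (by simpa using hr),
    ← Finset.add_sum_erase _ _ (Finset.mem_range.2 hr), Finset.sdiff_singleton_eq_erase]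
  ring

theorem mem_skewOfSize_one_iff (lam kap : StrictPartition) :
    lam ∈ kap.skewOfSize 1 ↔ ∃ r, Step kap lam r := by
  rw [mem_skewOfSize]
  constructor
  · rintro ⟨hc, hs⟩
    have h1 := lam.size_eq_sum_range (L := kap.length + lam.length) (by omega)
    have h2 := kap.size_eq_sum_range (L := kap.length + lam.length) (by omega)
    obtain ⟨r, hr, hlt⟩ : ∃ r ∈ Finset.range (kap.length + lam.length),
        kap.part r < lam.part r := by
      by_contra! h
      have := Finset.sum_le_sum h
      omega
    refine ⟨r, ?_⟩
    have hle : ∀ i ∈ Finset.range (kap.length + lam.length),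
        Function.update kap.part r (kap.part r + 1) i ≤ lam.part i := by
      intro i _
      by_cases hi : i = r
      · rw [hi, Function.update_self]
        exact hlt
      · rw [Function.update_of_ne hi]
        exact hc i
    have hsum : ∑ i ∈ Finset.range (kap.length + lam.length),
        Function.update kap.part r (kap.part r + 1) i =
        ∑ i ∈ Finset.range (kap.length + lam.length), lam.part i := by
      rw [Finset.sum_update_of_mem hr, ← h1, hs, h2, ← Finset.add_sum_erase _ _ hr,
        Finset.sdiff_singleton_eq_erase]
      ring
    have heq := (Finset.sum_eq_sum_iff_of_le hle).1 hsum
    funext i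
    by_cases hi : i < kap.length + lam.length
    · exact (heq i (Finset.mem_range.2 hi)).symm
    · have hir : i ≠ r := by
        rintro rfl
        exact hi (Finset.mem_range.1 hr)
      rw [Function.update_of_ne hir, (lam.part_eq_zero_iff i).2 (by omega),
        (kap.part_eq_zero_iff i).2 (by omega)]
  · rintro ⟨r, h⟩
    exact ⟨h.contains, h.size_eq⟩

/-- The set of the parts of a strict partition. -/
def partSet (lam : StrictPartition) : Finset ℕ := lam.parts.toFinset

theorem mem_partSet (lam : StrictPartition) (a : ℕ) :
    a ∈ lam.partSet ↔ 0 < a ∧ ∃ i, lam.part i = a := by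
  rw [partSet, List.mem_toFinset]
  constructor
  · intro h
    obtain ⟨i, hi, rfl⟩ := List.getElem_of_mem h
    exact ⟨lam.pos _ h, i, by rw [part, List.getD_eq_getElem _ _ hi]⟩
  · rintro ⟨h, i, rfl⟩
    have hi := (lam.part_pos_iff i).1 h
    rw [part, List.getD_eq_getElem _ _ hi]
    exact List.getElem_mem _

theorem zero_notMem_partSet (lam : StrictPartition) : 0 ∉ lam.partSet := by
  simp [mem_partSet]

theorem partSet_eq_image (lam : StrictPartition) :
    lam.partSet = (Finset.range lam.length).image lam.part := by
  ext a
  simp only [mem_partSet, Finset.mem_image, Finset.mem_range, ← part_pos_iff]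
  constructor
  · rintro ⟨h, i, rfl⟩
    exact ⟨i, h, rfl⟩
  · rintro ⟨i, h, rfl⟩
    exact ⟨h, i, rfl⟩

theorem part_injOn (lam : StrictPartition) :
    Set.InjOn lam.part (Finset.range lam.length : Set ℕ) := fun i hi _ _ h =>
  lam.part_injOn_pos ((lam.part_pos_iff i).2 (by simpa using hi)) h

theorem card_partSet (lam : StrictPartition) : lam.partSet.card = lam.length := by
  rw [partSet_eq_image, Finset.card_image_of_injOn lam.part_injOn, Finset.card_range]

theorem part_mem_insert (lam : StrictPartition) (i : ℕ) :
    lam.part i ∈ insert 0 lam.partSet := by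
  rw [Finset.mem_insert, mem_partSet]
  by_cases h : lam.part i = 0
  · exact Or.inl h
  · exact Or.inr ⟨by omega, i, rfl⟩

theorem Step.notMem {kap lam : StrictPartition} {r : ℕ} (h : Step kap lam r) :
    kap.part r + 1 ∉ kap.partSet := by
  rw [mem_partSet]
  rintro ⟨-, j, hj⟩
  have hjr : j ≠ r := by
    rintro rfl
    omega
  rw [← h.part_of_ne hjr, ← h.part_self] at hj
  exact hjr (lam.part_injOn_pos (by rw [hj, h.part_self]; omega) hj)

theorem Step.partSet_eq {kap lam : StrictPartition} {r : ℕ} (h : Step kap lam r) :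
    lam.partSet = insert (kap.part r + 1) (kap.partSet.erase (kap.part r)) := by
  ext b
  rw [Finset.mem_insert, Finset.mem_erase, mem_partSet, mem_partSet]
  constructor
  · rintro ⟨hb, j, rfl⟩
    by_cases hj : j = r
    · subst hj
      exact Or.inl h.part_self
    · right
      rw [h.part_of_ne hj] at hb ⊢
      exact ⟨fun he => hj (kap.part_injOn_pos hb he), hb, j, rfl⟩
  · rintro (rfl | ⟨hne, hb, j, rfl⟩)
    · exact ⟨by omega, r, h.part_self⟩
    · exact ⟨hb, j, h.part_of_ne fun hj => hne (hj ▸ rfl)⟩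

/-- The box goes to the first row of length a. For a = 0 this is the first empty row, so that
creating a row is also a move from a to a + 1. -/
theorem exists_step (kap : StrictPartition) {a : ℕ} (ha : a ∈ insert 0 kap.partSet)
    (ha' : a + 1 ∉ kap.partSet) : ∃ lam r, Step kap lam r ∧ kap.part r = a := by
  obtain ⟨r, hr, hprev⟩ : ∃ r, kap.part r = a ∧ ∀ i < r, a < kap.part i := by
    rcases Finset.mem_insert.1 ha with rfl | h
    · exact ⟨kap.length, (kap.part_eq_zero_iff _).2 le_rfl, fun i hi => (kap.part_pos_iff i).2 hi⟩
    · obtain ⟨hpos, r, rfl⟩ := (kap.mem_partSet a).1 h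
      refine ⟨r, rfl, fun i hi => kap.part_lt_part hi ?_⟩
      exact (kap.part_pos_iff i).2 (hi.trans ((kap.part_pos_iff r).1 hpos))
  obtain ⟨lam, hlam⟩ := exists_part_eq (Function.update kap.part r (kap.part r + 1)) (by
    intro i hi
    by_cases h1 : i + 1 = r
    · have hlt := hprev i (by omega)
      have hne : kap.part i ≠ a + 1 := by
        intro h
        exact ha' ((kap.mem_partSet _).2 ⟨by omega, i, h⟩)
      rw [h1, Function.update_self, Function.update_of_ne (by omega)]
      omega
    · rw [Function.update_of_ne h1] at hi ⊢
      have hlt : kap.part (i + 1) < kap.part i := by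
        refine kap.part_lt_part (by omega) ((kap.part_pos_iff i).2 ?_)
        have := (kap.part_pos_iff (i + 1)).1 hi
        omega
      by_cases h2 : i = r
      · subst h2
        rw [Function.update_self]
        omega
      · rwa [Function.update_of_ne h2])
    ⟨kap.length + r + 1, by
      rw [Function.update_of_ne (by omega), (kap.part_eq_zero_iff _).2 (by omega)]⟩
  exact ⟨lam, r, hlam, hr⟩

/-- One-box extensions correspond to the lengths that can grow. Distinct rows of equal length are
empty, and of these only the first can receive a box, so the old length determines the row. -/
theorem sum_skewOfSize_one {M : Type*} [AddCommMonoid M] (kap : StrictPartition)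
    (f : StrictPartition → M) (g : ℕ → M)
    (hfg : ∀ lam r, Step kap lam r → f lam = g (kap.part r)) :
    ∑ lam ∈ kap.skewOfSize 1, f lam =
      ∑ a ∈ insert 0 kap.partSet with a + 1 ∉ kap.partSet, g a := by
  classical
  choose! row hrow using fun lam (h : lam ∈ kap.skewOfSize 1) =>
    (mem_skewOfSize_one_iff lam kap).1 h
  refine Finset.sum_bij (fun lam _ => kap.part (row lam)) ?_ ?_ ?_ ?_
  · intro lam h
    exact Finset.mem_filter.2 ⟨kap.part_mem_insert _, (hrow lam h).notMem⟩
  · intro lam h lam' h' heq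
    apply eq_of_part_eq
    have e1 := hrow lam h
    have e2 := hrow lam' h'
    by_cases h0 : row lam = row lam'
    · rw [e1, e2, h0]
    · exfalso
      have hz : kap.part (row lam) = 0 := by
        by_contra hne
        exact h0 (kap.part_injOn_pos (by omega) heq)
      have key : ∀ {lam r r'}, Step kap lam r → r' < r → kap.part r' ≠ 0 := by
        intro lam r r' e hlt hz'
        have h1 : lam.part r' = 0 := by rw [e.part_of_ne (by omega), hz']
        have h2 := (lam.part_eq_zero_iff r').1 h1
        have h3 := (lam.part_eq_zero_iff r).2 (by omega)
        rw [e.part_self] at h3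
        omega
      rcases Nat.lt_or_gt_of_ne h0 with hlt | hlt
      · exact key e2 hlt hz
      · exact key e1 hlt (heq ▸ hz)
  · intro a ha
    rw [Finset.mem_filter] at ha
    obtain ⟨lam, r, hs, rfl⟩ := kap.exists_step ha.1 ha.2
    have hm := (mem_skewOfSize_one_iff lam kap).2 ⟨r, hs⟩
    refine ⟨lam, hm, ?_⟩
    have hs' := hrow lam hm
    by_contra hne
    have hr : row lam ≠ r := fun h => hne (h ▸ rfl)
    have h1 := hs.part_of_ne hr
    rw [hs'.part_self] at h1
    omega
  · intro lam h
    exact hfg lam _ (hrow lam h)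

end StrictPartition

/-! ### Linear extensions and removal of the last element -/

/-- Linear extensions of a relation on a type with `n` elements, as numberings by `Fin n`. -/
@[ext]
structure LinearNumbering {α : Type*} (R : α → α → Prop) (n : ℕ) where
  toEquiv : α ≃ Fin n
  lt : ∀ b c, R b c → toEquiv b < toEquiv c

namespace LinearNumbering

variable {α β : Type*}

instance [Finite α] (R : α → α → Prop) (n : ℕ) : Finite (LinearNumbering R n) :=
  Finite.of_injective toEquiv fun _ _ h => LinearNumbering.ext h

/-- Transport of linear extensions along an equivalence. -/
def congr {R : α → α → Prop} {S : β → β → Prop} (f : α ≃ β) (h : ∀ b c, R b c ↔ S (f b) (f c))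
    (n : ℕ) : LinearNumbering R n ≃ LinearNumbering S n where
  toFun e := ⟨f.symm.trans e.1, fun b c hbc => e.2 _ _ ((h _ _).2 (by simpa using hbc))⟩
  invFun e := ⟨f.trans e.1, fun b c hbc => e.2 _ _ ((h _ _).1 hbc)⟩
  left_inv e := LinearNumbering.ext (by ext; simp)
  right_inv e := LinearNumbering.ext (by ext; simp)

/-- Remove the last element from a linear extension. -/
def removeLast {R : α → α → Prop} {n : ℕ} {b : α} (e : LinearNumbering R (n + 1))
    (he : e.toEquiv b = Fin.last n) : LinearNumbering (fun x y : {x // x ≠ b} => R x y) n where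
  toEquiv :=
    { toFun := fun x => (e.toEquiv x).castPred fun h => x.2 (e.toEquiv.injective (h.trans he.symm))
      invFun := fun i => ⟨e.toEquiv.symm i.castSucc, fun h => by
        rw [Equiv.symm_apply_eq, he] at h
        exact i.castSucc_ne_last h⟩
      left_inv := fun x => by simp
      right_inv := fun i => by simp }
  lt x y hxy := by
    simpa [Fin.castPred_lt_castPred_iff] using e.lt x y hxy

/-- Append `b` as the last element to a linear extension. -/
def appendLast [DecidableEq α] {R : α → α → Prop} {n : ℕ} {b : α} (hb : ∀ c, ¬ R b c)
    (e : LinearNumbering (fun x y : {x // x ≠ b} => R x y) n) : LinearNumbering R (n + 1) where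
  toEquiv :=
    { toFun := fun x => if h : x = b then Fin.last n else (e.toEquiv ⟨x, h⟩).castSucc
      invFun := fun y => Fin.lastCases (motive := fun _ => α) b (fun i => (e.toEquiv.symm i).1) y
      left_inv := fun x => by
        by_cases h : x = b <;> simp [h]
      right_inv := fun y => by
        induction y using Fin.lastCases with
        | last => simp
        | cast i => simp [(e.toEquiv.symm i).2] }
  lt x y hxy := by
    have hx : x ≠ b := by
      rintro rfl
      exact hb _ hxy
    by_cases hy : y = b
    · simp [hx, hy, Fin.castSucc_lt_last]
    · simpa [hx, hy] using e.lt ⟨x, hx⟩ ⟨y, hy⟩ hxy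

/-- Linear extensions with a prescribed last element `b` are linear extensions of the rest. -/
def lastEquiv [DecidableEq α] {R : α → α → Prop} {n : ℕ} {b : α} (hb : ∀ c, ¬ R b c) :
    {e : LinearNumbering R (n + 1) // e.toEquiv b = Fin.last n} ≃
      LinearNumbering (fun x y : {x // x ≠ b} => R x y) n where
  toFun e := e.1.removeLast e.2
  invFun e := ⟨appendLast hb e, by simp [appendLast]⟩
  left_inv e := by
    apply Subtype.ext
    apply LinearNumbering.ext
    apply Equiv.ext
    intro x
    by_cases h : x = b
    · simp [h, e.2, appendLast]
    · simp [h, appendLast, removeLast]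
  right_inv e := by
    apply LinearNumbering.ext
    apply Equiv.ext
    intro x
    simp [appendLast, removeLast, x.2]

/-- The numberings are sorted by their last element `b`. If some `c` has to come after `b`, there
are none. -/
theorem card_succ [Fintype α] [DecidableEq α] (R : α → α → Prop)
    [DecidablePred fun b => ∀ c, ¬ R b c] (n : ℕ) :
    Nat.card (LinearNumbering R (n + 1)) = ∑ b : α with ∀ c, ¬ R b c,
      Nat.card (LinearNumbering (fun x y : {x // x ≠ b} => R x y) n) := by
  rw [Nat.card_congr (Equiv.sigmaFiberEquiv
    fun e : LinearNumbering R (n + 1) => e.toEquiv.symm (Fin.last n)).symm, Nat.card_sigma,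
    Finset.sum_filter]
  refine Finset.sum_congr rfl fun b _ => ?_
  split_ifs with hb
  · rw [← Nat.card_congr (lastEquiv hb)]
    refine Nat.card_congr (Equiv.subtypeEquivRight fun e => ?_)
    rw [Equiv.symm_apply_eq]
    exact eq_comm
  · push Not at hb
    obtain ⟨c, hc⟩ := hb
    rw [Nat.card_eq_zero]
    left
    constructor
    rintro ⟨e, he⟩
    have h1 := e.2 b c hc
    rw [Equiv.symm_apply_eq] at he
    rw [← he] at h1
    exact absurd (Fin.le_last _) (not_le.2 h1)

/-- The number of linear extensions of a relation on a finite set. -/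
noncomputable def count (R : α → α → Prop) (A : Finset α) : ℕ :=
  Nat.card (LinearNumbering (fun x y : {x // x ∈ A} => R x y) A.card)

theorem count_eq_sum [DecidableEq α] (R : α → α → Prop) {A : Finset α} (hA : A.Nonempty)
    [DecidablePred fun b => ∀ c ∈ A, ¬ R b c] :
    count R A = ∑ b ∈ A with ∀ c ∈ A, ¬ R b c, count R (A.erase b) := by
  classical
  obtain ⟨n, hn⟩ := Nat.exists_eq_succ_of_ne_zero hA.card_pos.ne'
  rw [count, hn, Nat.succ_eq_add_one, card_succ, Finset.sum_filter, Finset.sum_filter,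
    ← Finset.sum_attach A, Finset.univ_eq_attach]
  refine Finset.sum_congr rfl fun b _ => ?_
  refine if_congr ⟨fun h c hc => h ⟨c, hc⟩, fun h c => h c c.2⟩ ?_ rfl
  rw [count, Finset.card_erase_of_mem b.2, hn, Nat.succ_sub_one]
  refine Nat.card_congr (congr ?_ ?_ n)
  · exact {
      toFun := fun x => ⟨x.1.1, Finset.mem_erase.2 ⟨fun h => x.2 (Subtype.ext h), x.1.2⟩⟩
      invFun := fun x => ⟨⟨x.1, (Finset.mem_erase.1 x.2).2⟩,
        fun h => (Finset.mem_erase.1 x.2).1 (congrArg Subtype.val h)⟩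
      left_inv := fun x => rfl
      right_inv := fun x => rfl }
  · intro x y
    rfl

end LinearNumbering

/-! ### The branching rule for standard shifted tableaux -/

namespace StrictPartition

/-- The order that the entries of a tableau have to respect: `b` lies left of `c` in the same row
or above `c` in the same column. -/
def CellLT (b c : ℕ × ℕ) : Prop := (b.1 = c.1 ∧ b.2 < c.2) ∨ (b.2 = c.2 ∧ b.1 < c.1)

theorem numTableaux_eq_count (lam mu : StrictPartition) :
    lam.numTableaux mu = LinearNumbering.count CellLT (skewCells lam mu) := by
  refine Nat.card_congr {
    toFun := fun t => ⟨t.entry, ?_⟩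
    invFun := fun e => ⟨e.1, fun b c h1 h2 => e.2 b c (Or.inl ⟨h1, h2⟩),
      fun b c h1 h2 => e.2 b c (Or.inr ⟨h1, h2⟩)⟩
    left_inv := fun t => rfl
    right_inv := fun e => rfl }
  rintro b c (h | h)
  · exact t.row_lt b c h.1 h.2
  · exact t.col_lt b c h.1 h.2

/-- In a shifted diagram the right ends of the nonempty rows move weakly to the left on the way
down, because row i starts one column after row i - 1 and parts drop by at least one. -/
theorem part_add_le (lam : StrictPartition) {i j : ℕ} (hij : i ≤ j) (hj : 0 < lam.part j) :
    lam.part j + j ≤ lam.part i + i := by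
  induction j, hij using Nat.le_induction with
  | base => exact le_rfl
  | succ k hk ih =>
    have hk' : 0 < lam.part k := by
      rw [part_pos_iff] at hj ⊢
      omega
    have := lam.part_lt_part (Nat.lt_add_one k) hk'
    have := ih hk'
    omega

theorem Step.notMem_cells {kap lam : StrictPartition} {r : ℕ} (_ : Step kap lam r) :
    (r, r + kap.part r + 1) ∉ kap.cells := by
  rw [mem_cells]
  simp

theorem Step.cells_eq {kap lam : StrictPartition} {r : ℕ} (h : Step kap lam r) :
    lam.cells = insert (r, r + kap.part r + 1) kap.cells := by
  ext ⟨i, j⟩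
  rw [Finset.mem_insert, mem_cells, mem_cells, Prod.mk.injEq]
  by_cases hi : i = r
  · subst hi
    rw [h.part_self]
    simp only [true_and]
    omega
  · rw [h.part_of_ne hi]
    simp only [hi, false_and, false_or]

theorem Step.exists_of_maximal {lam mu : StrictPartition} (hmu : lam.Contains mu) {b : ℕ × ℕ}
    (hb : b ∈ skewCells lam mu) (hmax : ∀ c ∈ skewCells lam mu, ¬ CellLT b c) :
    ∃ kap, Step kap lam b.1 ∧ b.2 = b.1 + kap.part b.1 + 1 ∧ kap.Contains mu := by
  obtain ⟨i, j⟩ := b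
  simp only [skewCells, Finset.mem_sdiff, mem_cells, not_and, not_le] at hb hmax
  obtain ⟨⟨hij, hj⟩, hjmu⟩ := hb
  have hjmu := hjmu hij
  have hj' : j = i + lam.part i := by
    by_contra hne
    -- Otherwise the box to the right would also lie in the skew shape.
    exact hmax (i, j + 1) ⟨⟨by omega, by simp only; omega⟩, fun _ => by simp only; omega⟩
      (Or.inl ⟨rfl, by simp⟩)
  have hnext : 0 < lam.part (i + 1) → lam.part (i + 1) + 1 < lam.part i := by
    intro hpos
    have hlt := lam.part_lt_part (Nat.lt_add_one i) (by omega)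
    by_contra hle
    -- Otherwise row i + 1 ends in column j as well. The box there is not in `mu`, since row i of
    -- `mu` ends before column j and row i + 1 of `mu`, if nonempty, ends no later.
    refine hmax (i + 1, j) ⟨⟨by simp only; omega, by simp only; omega⟩, fun _ => ?_⟩
      (Or.inr ⟨rfl, by simp⟩)
    by_contra hle'
    simp only [not_lt] at hle'
    have := mu.part_add_le (Nat.le_add_right i 1) (by omega)
    omega
  obtain ⟨kap, hkap⟩ := exists_part_eq (Function.update lam.part i (lam.part i - 1)) (by
    intro k hk
    by_cases h1 : k + 1 = i
    · rw [h1, Function.update_self] at hk ⊢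
      rw [Function.update_of_ne (by omega)]
      have := lam.part_lt_part (Nat.lt_add_one k)
        (by rw [part_pos_iff]; have := (lam.part_pos_iff i).1 (by omega); omega)
      rw [h1] at this
      omega
    · rw [Function.update_of_ne h1] at hk ⊢
      by_cases h2 : k = i
      · subst h2
        rw [Function.update_self]
        have := hnext hk
        omega
      · rw [Function.update_of_ne h2]
        refine lam.part_lt_part (Nat.lt_add_one k) ?_
        rw [part_pos_iff] at hk ⊢
        omega) ⟨lam.length + i + 1, by
      rw [Function.update_of_ne (by omega), part_eq_zero_iff]
      omega⟩
  have hk : kap.part i = lam.part i - 1 := by rw [hkap, Function.update_self]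
  refine ⟨kap, ?_, ?_, ?_⟩
  · rw [Step, hk, hkap, Function.update_idem, Nat.sub_add_cancel (by omega),
      Function.update_eq_self]
  · simp only
    omega
  · intro k
    by_cases h : k = i
    · rw [h, hk]
      omega
    · rw [hkap, Function.update_of_ne h]
      exact hmu k

theorem Step.eq_of_eq {kap kap' lam : StrictPartition} {r : ℕ} (h : Step kap lam r)
    (h' : Step kap' lam r) : kap = kap' := by
  apply eq_of_part_eq
  funext i
  by_cases hi : i = r
  · have := h.part_self.symm.trans h'.part_self
    rw [hi]
    omega
  · rw [← h.part_of_ne hi, h'.part_of_ne hi]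

/-- The last entry occupies a maximal box of the skew shape. Such boxes are exactly those whose
removal leaves a strict partition containing `mu`. -/
theorem numTableaux_succ {lam mu : StrictPartition} {n : ℕ} (h : lam ∈ mu.skewOfSize (n + 1))
    [DecidablePred fun kap : StrictPartition => lam ∈ kap.skewOfSize 1] :
    lam.numTableaux mu =
      ∑ kap ∈ mu.skewOfSize n with lam ∈ kap.skewOfSize 1, kap.numTableaux mu := by
  classical
  rw [mem_skewOfSize] at h
  have hne : (skewCells lam mu).Nonempty := by
    rw [skewCells, Finset.sdiff_nonempty]
    intro hsub
    have hle : ∀ i, lam.part i ≤ mu.part i := by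
      intro i
      by_contra hlt
      have := hsub ((lam.mem_cells (i, i + lam.part i)).2 ⟨by simp only; omega, le_rfl⟩)
      rw [mem_cells] at this
      simp only at this
      omega
    have h1 := lam.size_eq_sum_range (L := lam.length + mu.length) (by omega)
    have h2 := mu.size_eq_sum_range (L := lam.length + mu.length) (by omega)
    have h3 := Finset.sum_le_sum fun i (_ : i ∈ Finset.range (lam.length + mu.length)) => hle i
    omega
  rw [numTableaux_eq_count, LinearNumbering.count_eq_sum _ hne]
  choose! row hrow using fun kap (h : lam ∈ skewOfSize kap 1) =>
    (mem_skewOfSize_one_iff lam kap).1 h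
  symm
  refine Finset.sum_bij (fun kap _ => (row kap, row kap + kap.part (row kap) + 1)) ?_ ?_ ?_ ?_
  · intro kap hk
    rw [Finset.mem_filter, mem_skewOfSize] at hk
    have hs := hrow kap hk.2
    rw [Finset.mem_filter]
    refine ⟨?_, ?_⟩
    · rw [skewCells, Finset.mem_sdiff, hs.cells_eq, mem_cells]
      refine ⟨Finset.mem_insert_self _ _, ?_⟩
      have := hk.1.1 (row kap)
      simp only
      omega
    · rintro ⟨i, j⟩ hc hlt
      rw [skewCells, Finset.mem_sdiff, mem_cells] at hc
      simp only at hc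
      rcases hlt with ⟨h1, h2⟩ | ⟨h1, h2⟩
      · simp only at h1 h2
        rw [← h1, hs.part_self] at hc
        omega
      · simp only at h1 h2
        rw [hs.part_of_ne (by omega)] at hc
        have := kap.part_add_le h2.le (by omega)
        omega
  · intro kap hk kap' hk' heq
    rw [Finset.mem_filter] at hk hk'
    have h1 := hrow kap hk.2
    have h2 := hrow kap' hk'.2
    rw [← (Prod.mk.inj heq).1] at h2
    exact h1.eq_of_eq h2
  · rintro ⟨i, j⟩ hb
    rw [Finset.mem_filter] at hb
    obtain ⟨kap, hs, hj, hc⟩ := Step.exists_of_maximal h.1 hb.1 hb.2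
    simp only at hs hj
    have hm := (mem_skewOfSize_one_iff lam kap).2 ⟨i, hs⟩
    have hsz := hs.size_eq
    refine ⟨kap, Finset.mem_filter.2 ⟨(mem_skewOfSize _ _ _).2 ⟨hc, by omega⟩, hm⟩, ?_⟩
    have hs' := hrow kap hm
    have hr : row kap = i := by
      by_contra hne
      have h1 := hs.part_of_ne hne
      rw [hs'.part_self] at h1
      omega
    rw [hr, hj]
  · intro kap hk
    rw [Finset.mem_filter] at hk
    have hs := hrow kap hk.2
    rw [numTableaux_eq_count]
    congr 1
    rw [skewCells, skewCells, hs.cells_eq, ← Finset.erase_sdiff_comm,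
      Finset.erase_insert hs.notMem_cells]

end StrictPartition

/-! ### Hook lengths row by row -/

namespace StrictPartition

theorem card_filter_row (lam : StrictPartition) (i j : ℕ) (hij : i < j) :
    (lam.cells.filter fun c => c.1 = i ∧ j < c.2).card = i + lam.part i - j := by
  rw [show (lam.cells.filter fun c => c.1 = i ∧ j < c.2) =
    (Finset.Ioc j (i + lam.part i)).image fun k => (i, k) from ?_,
    Finset.card_image_of_injective _ (Prod.mk_right_injective i), Nat.card_Ioc]
  ext ⟨a, b⟩
  simp only [Finset.mem_filter, mem_cells, Finset.mem_image, Finset.mem_Ioc, Prod.mk.injEq]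
  constructor
  · rintro ⟨⟨h1, h2⟩, rfl, h3⟩
    exact ⟨b, ⟨h3, h2⟩, rfl, rfl⟩
  · rintro ⟨k, ⟨h1, h2⟩, rfl, rfl⟩
    exact ⟨⟨by omega, h2⟩, rfl, h1⟩

/-- The number of boxes below row `i` in column `j`. -/
def legLength (lam : StrictPartition) (i j : ℕ) : ℕ :=
  ((Finset.Ioo i j).filter fun k => j ≤ k + lam.part k).card

theorem card_filter_col (lam : StrictPartition) (i j : ℕ) :
    (lam.cells.filter fun c => c.2 = j ∧ i < c.1).card = lam.legLength i j := by
  rw [legLength, show (lam.cells.filter fun c => c.2 = j ∧ i < c.1) =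
    ((Finset.Ioo i j).filter fun k => j ≤ k + lam.part k).image fun k => (k, j) from ?_,
    Finset.card_image_of_injective _ (Prod.mk_left_injective j)]
  ext ⟨a, b⟩
  simp only [Finset.mem_filter, mem_cells, Finset.mem_image, Finset.mem_Ioo, Prod.mk.injEq]
  constructor
  · rintro ⟨⟨h1, h2⟩, rfl, h3⟩
    exact ⟨a, ⟨⟨h3, h1⟩, h2⟩, rfl, rfl⟩
  · rintro ⟨k, ⟨⟨h1, h2⟩, h3⟩, rfl, rfl⟩
    exact ⟨⟨h2, h3⟩, rfl, h1⟩

theorem hookLength_eq (lam : StrictPartition) {i j : ℕ} (hij : i < j) :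
    lam.hookLength (i, j) = (i + lam.part i - j) + lam.legLength i j + 1 + lam.part j := by
  rw [hookLength, lam.card_filter_row i j hij, lam.card_filter_col i j]

theorem legLength_of_lt (lam : StrictPartition) {i j : ℕ} (hj : j < lam.length) :
    lam.legLength i j = j - i - 1 := by
  rw [legLength, Finset.filter_true_of_mem, Nat.card_Ioo]
  intro k hk
  have := lam.part_add_le (Finset.mem_Ioo.1 hk).2.le ((lam.part_pos_iff j).2 hj)
  omega

/-- Row ends move weakly to the left, so the rows below row i that reach column j form a run
starting with row i + 1. -/
theorem le_legLength_iff (lam : StrictPartition) {i j k : ℕ} (hj : lam.length ≤ j)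
    (hik : i < k) (hk : k < lam.length) :
    k - i ≤ lam.legLength i j ↔ j ≤ k + lam.part k := by
  constructor
  · intro h
    by_contra hlt
    have hsub : ((Finset.Ioo i j).filter fun k => j ≤ k + lam.part k) ⊆ Finset.Ioo i k := by
      intro m hm
      rw [Finset.mem_filter, Finset.mem_Ioo] at hm
      rw [Finset.mem_Ioo]
      refine ⟨hm.1.1, ?_⟩
      by_contra hkm
      have := lam.part_add_le (not_lt.1 hkm) (by omega)
      omega
    have := Finset.card_le_card hsub
    rw [Nat.card_Ioo] at this
    unfold legLength at h
    omega
  · intro h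
    have hsub : Finset.Ioc i k ⊆ (Finset.Ioo i j).filter fun k => j ≤ k + lam.part k := by
      intro m hm
      rw [Finset.mem_Ioc] at hm
      rw [Finset.mem_filter, Finset.mem_Ioo]
      have := lam.part_add_le hm.2 ((lam.part_pos_iff k).2 hk)
      omega
    have := Finset.card_le_card hsub
    rw [Nat.card_Ioc] at this
    exact this

theorem legLength_le (lam : StrictPartition) {i : ℕ} (j : ℕ) (hi : i < lam.length) :
    lam.legLength i j ≤ lam.length - 1 - i := by
  have hsub : ((Finset.Ioo i j).filter fun k => j ≤ k + lam.part k) ⊆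
      Finset.Ioo i lam.length := by
    intro m hm
    rw [Finset.mem_filter, Finset.mem_Ioo] at hm
    rw [Finset.mem_Ioo, ← part_pos_iff]
    omega
  have := Finset.card_le_card hsub
  rw [Nat.card_Ioo] at this
  unfold legLength
  omega

theorem legLength_anti (lam : StrictPartition) {i j j' : ℕ} (hj : lam.length ≤ j)
    (hjj : j ≤ j') : lam.legLength i j' ≤ lam.legLength i j := by
  refine Finset.card_le_card fun m hm => ?_
  rw [Finset.mem_filter, Finset.mem_Ioo] at hm ⊢
  have hm' : m < lam.length := by
    rw [← part_pos_iff]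
    omega
  omega

/-- The hook lengths in row `i` beyond the staircase part, together with the differences
`lam_i - lam_k` for `k > i`, are the numbers from `1` to `lam_i`. -/
theorem prod_hookLength_mul_prod_sub (lam : StrictPartition) {i : ℕ} (hi : i < lam.length) :
    (∏ j ∈ Finset.Icc lam.length (i + lam.part i), lam.hookLength (i, j)) *
      ∏ k ∈ Finset.Ioo i lam.length, (lam.part i - lam.part k) = (lam.part i).factorial := by
  have hpos := (lam.part_pos_iff i).2 hi
  have hlast := lam.part_add_le (i := i) (j := lam.length - 1) (by omega)
    ((lam.part_pos_iff _).2 (by omega))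
  have hlast' := (lam.part_pos_iff (lam.length - 1)).2 (by omega)
  have hlt : ∀ k ∈ Finset.Ioo i lam.length, 0 < lam.part k ∧ lam.part k < lam.part i :=
    fun k hk => ⟨(lam.part_pos_iff k).2 (Finset.mem_Ioo.1 hk).2,
      lam.part_lt_part (Finset.mem_Ioo.1 hk).1 hpos⟩
  have hhook : ∀ j ∈ Finset.Icc lam.length (i + lam.part i), lam.hookLength (i, j) =
      (i + lam.part i - j) + lam.legLength i j + 1 := by
    intro j hj
    rw [Finset.mem_Icc] at hj
    rw [hookLength_eq _ (by omega), (lam.part_eq_zero_iff j).2 hj.1, add_zero]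
  have hinj1 : Set.InjOn (fun j => lam.hookLength (i, j))
      (Finset.Icc lam.length (i + lam.part i) : Set ℕ) := by
    have key : ∀ j ∈ Finset.Icc lam.length (i + lam.part i),
        ∀ j' ∈ Finset.Icc lam.length (i + lam.part i), j < j' →
        lam.hookLength (i, j') < lam.hookLength (i, j) := by
      intro j hj j' hj' hjj
      rw [hhook j hj, hhook j' hj']
      rw [Finset.mem_Icc] at hj hj'
      have := lam.legLength_anti (i := i) hj.1 hjj.le
      omega
    intro j hj j' hj' heq
    simp only at heq
    rcases lt_trichotomy j j' with h | h | h
    · have := key j hj j' hj' h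
      omega
    · exact h
    · have := key j' hj' j hj h
      omega
  have hinj2 : Set.InjOn (fun k => lam.part i - lam.part k)
      (Finset.Ioo i lam.length : Set ℕ) := by
    intro k hk k' hk' heq
    have h1 := hlt k hk
    have h2 := hlt k' hk'
    simp only at heq
    exact lam.part_injOn_pos h1.1 (by omega)
  have hdisj : Disjoint
      ((Finset.Icc lam.length (i + lam.part i)).image fun j => lam.hookLength (i, j))
      ((Finset.Ioo i lam.length).image fun k => lam.part i - lam.part k) := by
    rw [Finset.disjoint_left]
    intro x hx hx'
    rw [Finset.mem_image] at hx hx'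
    obtain ⟨j, hj, rfl⟩ := hx
    obtain ⟨k, hk, heq⟩ := hx'
    have h1 := hlt k hk
    rw [hhook j hj] at heq
    rw [Finset.mem_Icc] at hj
    rw [Finset.mem_Ioo] at hk
    -- Equality would mean that the leg length is j - λ_k - i - 1. If row k reaches column j, the
    -- leg has length at least k - i, which is too long; if not, at most k - i - 1, which is too
    -- short.
    have h2 := lam.le_legLength_iff hj.1 hk.1 hk.2
    omega
  rw [← Finset.prod_image (f := fun x => x) hinj1, ← Finset.prod_image (f := fun x => x) hinj2,
    ← Finset.prod_union, ← Finset.prod_Ico_id_eq_factorial]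
  -- Both sets lie in {1, …, λ_i}, and they are disjoint with (i + λ_i - ℓ + 1) + (ℓ - i - 1) = λ_i
  -- elements together.
  · refine Finset.prod_congr (Finset.eq_of_subset_of_card_le ?_ ?_) fun _ _ => rfl
    · intro x hx
      rw [Finset.mem_union, Finset.mem_image, Finset.mem_image] at hx
      rw [Finset.mem_Ico]
      rcases hx with ⟨j, hj, rfl⟩ | ⟨k, hk, rfl⟩
      · rw [hhook j hj]
        rw [Finset.mem_Icc] at hj
        have := lam.legLength_le j hi
        omega
      · have := hlt k hk
        omega
    · rw [Finset.card_union_of_disjoint hdisj, Finset.card_image_of_injOn hinj1,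
        Finset.card_image_of_injOn hinj2]
      · simp only [Nat.card_Icc, Nat.card_Ioo, Nat.card_Ico]
        omega
  · exact hdisj

/-- In the columns i < j < ℓ all rows between i and j reach column j, so the leg length is j - i - 1
and the hook length is λ_i + λ_j. The remaining columns contribute the factorial. -/
theorem prod_row_mul_prod_sub (lam : StrictPartition) {i : ℕ} (hi : i < lam.length) :
    (∏ j ∈ Finset.Icc (i + 1) (i + lam.part i), lam.hookLength (i, j)) *
        ∏ k ∈ Finset.Ioo i lam.length, (lam.part i - lam.part k) =
      (lam.part i).factorial * ∏ k ∈ Finset.Ioo i lam.length, (lam.part i + lam.part k) := by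
  have hlast := lam.part_add_le (i := i) (j := lam.length - 1) (by omega)
    ((lam.part_pos_iff _).2 (by omega))
  have hlast' := (lam.part_pos_iff (lam.length - 1)).2 (by omega)
  have hsplit : Finset.Icc (i + 1) (i + lam.part i) =
      Finset.Ioo i lam.length ∪ Finset.Icc lam.length (i + lam.part i) := by
    ext j
    simp only [Finset.mem_union, Finset.mem_Icc, Finset.mem_Ioo]
    omega
  have hdisj : Disjoint (Finset.Ioo i lam.length) (Finset.Icc lam.length (i + lam.part i)) := by
    rw [Finset.disjoint_left]
    intro j h1 h2
    rw [Finset.mem_Ioo] at h1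
    rw [Finset.mem_Icc] at h2
    omega
  have hhook : ∀ j ∈ Finset.Ioo i lam.length,
      lam.hookLength (i, j) = lam.part i + lam.part j := by
    intro j hj
    rw [Finset.mem_Ioo] at hj
    rw [hookLength_eq _ hj.1, legLength_of_lt _ hj.2]
    omega
  rw [hsplit, Finset.prod_union hdisj, Finset.prod_congr rfl hhook, mul_assoc,
    prod_hookLength_mul_prod_sub _ hi, mul_comm]

theorem hookProduct_eq_prod_rows (lam : StrictPartition) :
    lam.hookProduct = ∏ i ∈ Finset.range lam.length,
      ∏ j ∈ Finset.Icc (i + 1) (i + lam.part i), lam.hookLength (i, j) := by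
  rw [hookProduct, cells, Finset.prod_biUnion]
  · exact Finset.prod_congr rfl fun i _ => Finset.prod_image fun _ _ _ _ h => (Prod.mk.inj h).2
  · intro i _ i' _ hne
    rw [Function.onFun, Finset.disjoint_left]
    intro b hb hb'
    obtain ⟨j, -, rfl⟩ := Finset.mem_image.1 hb
    obtain ⟨j', -, h⟩ := Finset.mem_image.1 hb'
    exact hne (Prod.mk.inj h).1.symm

theorem hookProduct_pos (lam : StrictPartition) : 0 < lam.hookProduct :=
  Finset.prod_pos fun b _ => by
    unfold hookLength
    omega

end StrictPartition

/-! ### The hook product as a function of the set of parts -/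

section HookValue

variable (K : Type*) [Field K]

/-- The factor of the hook product that belongs to a pair of parts. -/
noncomputable def pairFactor (a b : ℕ) : K := ((a : K) + b) / (Nat.dist a b : K)

theorem pairFactor_comm (a b : ℕ) : pairFactor K a b = pairFactor K b a := by
  rw [pairFactor, pairFactor, Nat.dist_comm, add_comm]

theorem pairFactor_zero_right [CharZero K] {a : ℕ} (ha : a ≠ 0) : pairFactor K a 0 = 1 := by
  rw [pairFactor, Nat.dist_zero_right, Nat.cast_zero, add_zero,
    div_self (Nat.cast_ne_zero.2 ha)]

/-- The product formula for the hook product in terms of the set of parts. -/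
noncomputable def hookValue (S : Finset ℕ) : K :=
  (∏ a ∈ S, (a.factorial : K)) * ∏ a ∈ S, ∏ b ∈ S, if b < a then pairFactor K a b else 1

theorem hookValue_insert {S : Finset ℕ} {x : ℕ} (hx : x ∉ S) :
    hookValue K (insert x S) =
      hookValue K S * ((x.factorial : K) * ∏ b ∈ S, pairFactor K x b) := by
  have h1 : ∏ b ∈ S, pairFactor K x b = (∏ b ∈ S, if b < x then pairFactor K x b else 1) *
      ∏ b ∈ S, if x < b then pairFactor K b x else 1 := by
    rw [← Finset.prod_mul_distrib]
    refine Finset.prod_congr rfl fun b hb => ?_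
    have hne : b ≠ x := fun h => hx (h ▸ hb)
    rcases Nat.lt_or_gt_of_ne hne with h | h
    · rw [if_pos h, if_neg (by omega), mul_one]
    · rw [if_neg (by omega), if_pos h, one_mul, pairFactor_comm]
  have h2 : ∀ a ∈ S, (∏ b ∈ insert x S, if b < a then pairFactor K a b else 1) =
      (if x < a then pairFactor K a x else 1) * ∏ b ∈ S, if b < a then pairFactor K a b else 1 :=
    fun a _ => Finset.prod_insert hx
  rw [hookValue, hookValue, h1, Finset.prod_insert hx, Finset.prod_insert hx,
    Finset.prod_insert hx, Finset.prod_congr rfl h2, Finset.prod_mul_distrib,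
    if_neg (lt_irrefl x)]
  ring

/-- Since 0! = 1 and every pair with 0 contributes 1, an empty row may be treated as a part 0. This
makes the creation of a row a special case of moving a to a + 1. -/
theorem hookValue_insert_zero [CharZero K] {S : Finset ℕ} (hS : 0 ∉ S) :
    hookValue K (insert 0 S) = hookValue K S := by
  rw [hookValue_insert K hS, Finset.prod_eq_one fun b hb => ?_]
  · simp
  · rw [pairFactor_comm, pairFactor_zero_right]
    exact fun h => hS (h ▸ hb)

theorem StrictPartition.cast_hookProduct [CharZero K] (lam : StrictPartition) :
    (lam.hookProduct : K) = hookValue K lam.partSet := by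
  have hinj := lam.part_injOn
  rw [hookValue, lam.partSet_eq_image, Finset.prod_image hinj, Finset.prod_image hinj,
    ← Finset.prod_mul_distrib, lam.hookProduct_eq_prod_rows, Nat.cast_prod]
  refine Finset.prod_congr rfl fun i hi => ?_
  have hi := Finset.mem_range.1 hi
  have hpos := (lam.part_pos_iff i).2 hi
  have hlt : ∀ k ∈ Finset.Ioo i lam.length, lam.part k < lam.part i :=
    fun k hk => lam.part_lt_part (Finset.mem_Ioo.1 hk).1 hpos
  have hpair : (∏ b ∈ (Finset.range lam.length).image lam.part,
      if b < lam.part i then pairFactor K (lam.part i) b else 1) =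
      ∏ k ∈ Finset.Ioo i lam.length,
        (((lam.part i + lam.part k : ℕ) : K) / ((lam.part i - lam.part k : ℕ) : K)) := by
    rw [Finset.prod_image hinj]
    -- The parts smaller than λ_i are exactly those of the later rows.
    rw [← Finset.prod_subset (s₁ := Finset.Ioo i lam.length)]
    · refine Finset.prod_congr rfl fun k hk => ?_
      rw [if_pos (hlt k hk), pairFactor, Nat.dist_eq_sub_of_le_right (hlt k hk).le,
        Nat.cast_add]
    · intro k hk
      exact Finset.mem_range.2 (Finset.mem_Ioo.1 hk).2
    · intro k hk hk'
      rw [Finset.mem_range] at hk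
      rw [Finset.mem_Ioo] at hk'
      rw [if_neg]
      rcases Nat.lt_or_ge k i with h | h
      · exact (lam.part_lt_part h ((lam.part_pos_iff k).2 hk)).not_gt
      · rw [show k = i by omega]
        exact lt_irrefl _
  have hrow := congrArg (Nat.cast : ℕ → K) (lam.prod_row_mul_prod_sub hi)
  rw [Nat.cast_mul, Nat.cast_mul, Nat.cast_prod (R := K) _ (Finset.Ioo i lam.length)] at hrow
  rw [Nat.cast_prod (R := K) _ (Finset.Ioo i lam.length)] at hrow
  rw [hpair, Finset.prod_div_distrib, ← mul_div_assoc, eq_div_iff, hrow]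
  rw [Finset.prod_ne_zero_iff]
  intro k hk
  have := hlt k hk
  exact Nat.cast_ne_zero.2 (by omega)

end HookValue

/-! ### Lagrange interpolation for reversed polynomials -/

section LagrangeReversed

open Polynomial

theorem prod_one_sub_mul_eq {K ι : Type*} [Field K] (A : Finset ι) (z : ι → K) {t : K}
    (ht : t ≠ 0) : ∏ b ∈ A, (1 - z b * t) = t ^ A.card * ∏ b ∈ A, (t⁻¹ - z b) := by
  rw [← Finset.prod_const, ← Finset.prod_mul_distrib]
  refine Finset.prod_congr rfl fun b _ => ?_
  field_simp

/-- The polynomial ∏ (X - y_b) has degree less than the number of nodes x_a, so it equals its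
interpolant. Evaluating at 1/t and multiplying by t^|U| gives the identity at every t ≠ 0. -/
theorem prod_one_sub_eq_sum_lagrange {K ι κ : Type*} [Field K] [Infinite K] [DecidableEq ι]
    (s : Finset ι) (U : Finset κ) (x : ι → K) (y : κ → K) (hx : Set.InjOn x s)
    (hcard : s.card = U.card + 1) :
    ∏ b ∈ U, (1 - C (y b) * X) =
      ∑ a ∈ s, C ((∏ b ∈ U, (x a - y b)) / ∏ b ∈ s.erase a, (x a - x b)) *
        ∏ b ∈ s.erase a, (1 - C (x b) * X) := by
  refine eq_of_infinite_eval_eq _ _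
    (((Set.finite_singleton (0 : K)).infinite_compl).mono fun t ht => ?_)
  have ht : t ≠ 0 := ht
  have hdeg : (∏ b ∈ U, (X - C (y b))).degree < (s.card : WithBot ℕ) := by
    rw [degree_prod, hcard]
    simp only [degree_X_sub_C, Finset.sum_const, nsmul_eq_mul, mul_one]
    exact_mod_cast Nat.lt_succ_self _
  have hL := congrArg (eval t⁻¹) (Lagrange.eq_interpolate hx hdeg)
  rw [Lagrange.interpolate_apply] at hL
  simp only [eval_prod, eval_finsetSum, eval_mul, eval_C, eval_sub, eval_X, Lagrange.basis,
    Lagrange.basisDivisor] at hL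
  simp only [Set.mem_ofPred_eq, eval_prod, eval_finsetSum, eval_mul, eval_C, eval_sub, eval_X,
    eval_one]
  rw [prod_one_sub_mul_eq U y ht, hL, Finset.mul_sum]
  refine Finset.sum_congr rfl fun a ha => ?_
  rw [prod_one_sub_mul_eq _ x ht, Finset.card_erase_of_mem ha, hcard, Nat.add_sub_cancel,
    Finset.prod_mul_distrib, Finset.prod_inv_distrib, div_eq_mul_inv]
  ring

end LagrangeReversed

/-! ### Transition weights and the generating function of their moments -/

section Weights

variable (K : Type*) [Field K]

/-- The value `a (a + 1)`, twice `binom (a + 1) 2`. -/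
def pronic (a : ℕ) : K := (a : K) * (a + 1)

/-- The value `a (a - 1)`, twice `binom a 2`. -/
def lowerPronic (a : ℕ) : K := (a : K) * (a - 1)

theorem lowerPronic_succ (a : ℕ) : lowerPronic K (a + 1) = pronic K a := by
  simp only [lowerPronic, pronic, Nat.cast_add, Nat.cast_one]
  ring

theorem pronic_zero : pronic K 0 = 0 := by simp [pronic]

theorem lowerPronic_zero : lowerPronic K 0 = 0 := by simp [lowerPronic]

theorem pronic_injective [CharZero K] : Function.Injective (pronic K) := by
  intro a b h
  have h' : a * (a + 1) = b * (b + 1) := by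
    have : ((a * (a + 1) : ℕ) : K) = ((b * (b + 1) : ℕ) : K) := by
      push_cast
      exact h
    exact_mod_cast this
  nlinarith [h', Nat.lt_trichotomy a b]

/-- The transition weight of replacing the part `a` by `a + 1`. -/
noncomputable def stepWeight (S : Finset ℕ) (a : ℕ) : K :=
  (∏ b ∈ S, (pronic K a - lowerPronic K b)) /
    ∏ b ∈ (insert 0 S).erase a, (pronic K a - pronic K b)

/-- The factor at b = a + 1 vanishes. So forbidden moves have weight 0, and sums over addable boxes
extend to all of S ∪ {0}, as the interpolation formula needs. -/
theorem stepWeight_eq_zero {S : Finset ℕ} {a : ℕ} (h : a + 1 ∈ S) : stepWeight K S a = 0 := by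
  rw [stepWeight, Finset.prod_eq_zero h (by rw [lowerPronic_succ, sub_self]), zero_div]

theorem insert_zero_move {S : Finset ℕ} {a : ℕ} :
    insert 0 (insert (a + 1) (S.erase a)) = insert 0 (insert (a + 1) ((insert 0 S).erase a)) := by
  ext b
  simp only [Finset.mem_insert, Finset.mem_erase]
  tauto

theorem hookValue_insert_zero_of_any [CharZero K] (S : Finset ℕ) :
    hookValue K (insert 0 S) = hookValue K S := by
  by_cases h : 0 ∈ S
  · rw [Finset.insert_eq_of_mem h]
  · exact hookValue_insert_zero K h

/-- The differences factor as a(a+1) - b(b+1) = (a - b)(a + b + 1) and a(a+1) - b(b-1) = (a + b)(a +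
1 - b). Both sides are therefore ±(a + b)(a + b + 1), with equal signs because b is neither a nor a
+ 1. -/
theorem pairFactor_div_pairFactor [CharZero K] {a b : ℕ} (h : b ≠ a) (h' : b ≠ a + 1) :
    pairFactor K a b * (pronic K a - pronic K b) =
      pairFactor K (a + 1) b * (pronic K a - lowerPronic K b) := by
  rw [pairFactor, pairFactor, pronic, pronic, lowerPronic]
  rcases Nat.lt_or_gt_of_ne h with hlt | hlt
  · obtain ⟨c, rfl⟩ := Nat.exists_eq_add_of_lt hlt
    rw [Nat.dist_eq_sub_of_le_right (by omega), Nat.dist_eq_sub_of_le_right (by omega),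
      show b + c + 1 - b = c + 1 by omega, show b + c + 1 + 1 - b = c + 2 by omega]
    have h1 : ((c + 1 : ℕ) : K) ≠ 0 := Nat.cast_ne_zero.2 (by omega)
    have h2 : ((c + 2 : ℕ) : K) ≠ 0 := Nat.cast_ne_zero.2 (by omega)
    rw [div_mul_eq_mul_div, div_mul_eq_mul_div, div_eq_div_iff h1 h2]
    push_cast
    ring
  · obtain ⟨c, rfl⟩ : ∃ c, b = a + c + 2 := ⟨b - a - 2, by omega⟩
    rw [Nat.dist_eq_sub_of_le (by omega), Nat.dist_eq_sub_of_le (by omega),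
      show a + c + 2 - a = c + 2 by omega, show a + c + 2 - (a + 1) = c + 1 by omega]
    have h1 : ((c + 1 : ℕ) : K) ≠ 0 := Nat.cast_ne_zero.2 (by omega)
    have h2 : ((c + 2 : ℕ) : K) ≠ 0 := Nat.cast_ne_zero.2 (by omega)
    rw [div_mul_eq_mul_div, div_mul_eq_mul_div, div_eq_div_iff h2 h1]
    push_cast
    ring

theorem prod_pronic_sub_ne_zero [CharZero K] (T : Finset ℕ) {a : ℕ} (h : a ∉ T) :
    ∏ b ∈ T, (pronic K a - pronic K b) ≠ 0 :=
  Finset.prod_ne_zero_iff.2 fun _ hb =>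
    sub_ne_zero.2 fun he => h (pronic_injective K he ▸ hb)

/-- The ratio of the hook products before and after adding a box. -/
theorem hookValue_move [CharZero K] {S : Finset ℕ} (hS : 0 ∉ S) {a : ℕ} (ha : a ∈ insert 0 S)
    (ha' : a + 1 ∉ S) :
    (if a = 0 then 1 else 2) * hookValue K S =
      stepWeight K S a * hookValue K (insert (a + 1) (S.erase a)) := by
  set T := (insert 0 S).erase a with hT
  have haT : a ∉ T := Finset.notMem_erase _ _
  have haT' : a + 1 ∉ T := fun h => by
    rcases Finset.mem_insert.1 (Finset.mem_of_mem_erase h) with h | h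
    · omega
    · exact ha' h
  have e1 : hookValue K S =
      hookValue K T * ((a.factorial : K) * ∏ b ∈ T, pairFactor K a b) := by
    rw [← hookValue_insert_zero_of_any, ← Finset.insert_erase ha, hookValue_insert K haT]
  have e2 : hookValue K (insert (a + 1) (S.erase a)) =
      hookValue K T * (((a + 1).factorial : K) * ∏ b ∈ T, pairFactor K (a + 1) b) := by
    rw [← hookValue_insert_zero_of_any, insert_zero_move, hookValue_insert_zero_of_any,
      hookValue_insert K haT']
  have e3 : (∏ b ∈ T, pairFactor K a b) * ∏ b ∈ T, (pronic K a - pronic K b) =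
      (∏ b ∈ T, pairFactor K (a + 1) b) * ∏ b ∈ T, (pronic K a - lowerPronic K b) := by
    rw [← Finset.prod_mul_distrib, ← Finset.prod_mul_distrib]
    exact Finset.prod_congr rfl fun b hb => pairFactor_div_pairFactor K
      (fun h => haT (h ▸ hb)) (fun h => haT' (h ▸ hb))
  -- For a ≠ 0 the set T contains 0 in place of a. The factor at 0 is a(a+1), the one at a is 2a,
  -- which produces both the 2 and the a + 1; the latter cancels against (a+1)!/a!.
  have e4 : (if a = 0 then 1 else 2) * ∏ b ∈ T, (pronic K a - lowerPronic K b) =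
      ((a : K) + 1) * ∏ b ∈ S, (pronic K a - lowerPronic K b) := by
    split_ifs with h0
    · subst h0
      rw [hT, Finset.erase_insert hS]
      simp
    · have h1 : ∏ b ∈ insert 0 S, (pronic K a - lowerPronic K b) =
          (pronic K a - lowerPronic K a) * ∏ b ∈ T, (pronic K a - lowerPronic K b) := by
        rw [hT, Finset.mul_prod_erase _ (fun b => pronic K a - lowerPronic K b) ha]
      rw [Finset.prod_insert hS, lowerPronic_zero, sub_zero] at h1
      have h2 : pronic K a - lowerPronic K a = 2 * a := by
        rw [pronic, lowerPronic]
        ring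
      rw [h2] at h1
      have hp : pronic K a = a * (a + 1) := rfl
      have h3 : (a : K) ≠ 0 := Nat.cast_ne_zero.2 h0
      apply mul_left_cancel₀ h3
      linear_combination (∏ b ∈ S, (pronic K a - lowerPronic K b)) * hp - h1
  have hD := prod_pronic_sub_ne_zero K T haT
  rw [e1, e2, stepWeight, ← hT, div_mul_eq_mul_div, eq_div_iff hD, Nat.factorial_succ]
  push_cast
  linear_combination (hookValue K T * a.factorial) * ((if a = 0 then 1 else 2) * e3 +
    (∏ b ∈ T, pairFactor K (a + 1) b) * e4)

/-- The moments of the transition weights. -/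
noncomputable def moment (S : Finset ℕ) (k : ℕ) : K :=
  ∑ a ∈ insert 0 S, stepWeight K S a * pronic K a ^ k

open PowerSeries

theorem mk_pow_mul_one_sub (z : K) : (mk fun k => z ^ k) * (1 - C z * X) = 1 := by
  ext k
  cases k with
  | zero => simp
  | succ k =>
    rw [mul_sub, mul_one, map_sub, ← mul_assoc, coeff_succ_mul_X, coeff_mul_C, coeff_mk,
      coeff_mk, coeff_one, if_neg (Nat.succ_ne_zero k), pow_succ, sub_self]

/-- The generating function of the moments. -/
theorem mk_moment_mul_prod [CharZero K] {S : Finset ℕ} (hS : 0 ∉ S) :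
    (mk (moment K S)) * ∏ b ∈ S, (1 - C (pronic K b) * X) =
      ∏ b ∈ S, (1 - C (lowerPronic K b) * X) := by
  have h1 : mk (moment K S) =
      ∑ a ∈ insert 0 S, C (stepWeight K S a) * mk fun k => pronic K a ^ k := by
    ext k
    simp only [coeff_mk, map_sum, coeff_C_mul, moment]
  have h2 : ∏ b ∈ S, (1 - C (pronic K b) * X) =
      ∏ b ∈ insert 0 S, (1 - C (pronic K b) * X) := by
    rw [Finset.prod_insert hS, pronic_zero]
    simp
  -- The nodes are p(a) for a ∈ S ∪ {0}, one more than the zeros b(b-1) for b ∈ S. The Lagrange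
  -- coefficients are the weights `stepWeight` by definition.
  have h3 := congrArg (fun p : Polynomial K => (p : K⟦X⟧))
    (prod_one_sub_eq_sum_lagrange (insert 0 S) S (pronic K) (lowerPronic K)
      (pronic_injective K).injOn (Finset.card_insert_of_notMem hS))
  simp only [← Polynomial.coeToPowerSeries.ringHom_apply, map_prod, map_sum, map_mul, map_sub,
    map_one] at h3
  simp only [Polynomial.coeToPowerSeries.ringHom_apply, Polynomial.coe_C, Polynomial.coe_X] at h3
  rw [h1, h2, h3, Finset.sum_mul]
  refine Finset.sum_congr rfl fun a ha => ?_
  rw [← Finset.mul_prod_erase _ (fun b => 1 - C (pronic K b) * X) ha]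
  change _ = C (stepWeight K S a) * _
  linear_combination (C (stepWeight K S a) *
    ∏ b ∈ (insert 0 S).erase a, (1 - C (pronic K b) * X)) * mk_pow_mul_one_sub K (pronic K a)

/-- The effect of adding a box on the generating function of the moments. -/
theorem mk_moment_move [CharZero K] {S : Finset ℕ} (hS : 0 ∉ S) {a : ℕ} (ha : a ∈ insert 0 S)
    (ha' : a + 1 ∉ S) :
    (mk (moment K (insert (a + 1) (S.erase a)))) *
        (1 - C (pronic K (a + 1)) * X) * (1 - C (lowerPronic K a) * X) =
      mk (moment K S) * (1 - C (pronic K a) * X) ^ 2 := by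
  set T := (insert 0 S).erase a with hT
  have haT : a ∉ T := Finset.notMem_erase _ _
  have haT' : a + 1 ∉ T := fun h => by
    rcases Finset.mem_insert.1 (Finset.mem_of_mem_erase h) with h | h
    · omega
    · exact ha' h
  have hS' : 0 ∉ insert (a + 1) (S.erase a) := by
    rw [Finset.mem_insert, Finset.mem_erase]
    rintro (h | h)
    · omega
    · exact hS h.2
  have hz : ∀ (f : ℕ → K⟦X⟧) (A : Finset ℕ), f 0 = 1 → ∏ b ∈ insert 0 A, f b = ∏ b ∈ A, f b :=
    fun f A h => Finset.prod_insert_of_eq_one_if_notMem fun _ => h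
  -- All factors at 0 are 1, so 0 may be adjoined freely. The sets before and after the move then
  -- become a and a + 1 together with the common rest T.
  have h1 : ∀ f : ℕ → K⟦X⟧, f 0 = 1 → ∏ b ∈ S, f b = f a * ∏ b ∈ T, f b := by
    intro f hf
    rw [hT, Finset.mul_prod_erase _ f ha, hz f S hf]
  have h2 : ∀ f : ℕ → K⟦X⟧, f 0 = 1 →
      ∏ b ∈ insert (a + 1) (S.erase a), f b = f (a + 1) * ∏ b ∈ T, f b := by
    intro f hf
    rw [← hz f _ hf, insert_zero_move, hz f _ hf, Finset.prod_insert haT']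
  have hv0 : (1 - C (pronic K 0) * X : K⟦X⟧) = 1 := by simp [pronic_zero]
  have hu0 : (1 - C (lowerPronic K 0) * X : K⟦X⟧) = 1 := by simp [lowerPronic_zero]
  have e1 := mk_moment_mul_prod K hS
  have e2 := mk_moment_mul_prod K hS'
  rw [h1 (fun b => 1 - C (pronic K b) * X) hv0, h1 (fun b => 1 - C (lowerPronic K b) * X) hu0]
    at e1
  rw [h2 (fun b => 1 - C (pronic K b) * X) hv0, h2 (fun b => 1 - C (lowerPronic K b) * X) hu0,
    lowerPronic_succ] at e2
  have hD : ∏ b ∈ T, (1 - C (pronic K b) * X : K⟦X⟧) ≠ 0 := by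
    rw [Finset.prod_ne_zero_iff]
    intro b _ h
    have := congrArg constantCoeff h
    simp at this
  apply mul_right_cancel₀ hD
  linear_combination (1 - C (lowerPronic K a) * X) * e2 - (1 - C (pronic K a) * X) * e1

theorem pronic_succ_add_lowerPronic (a : ℕ) :
    pronic K (a + 1) + lowerPronic K a = 2 * pronic K a + 2 := by
  simp only [pronic, lowerPronic, Nat.cast_add, Nat.cast_one]
  ring

theorem pronic_succ_mul_lowerPronic (a : ℕ) :
    pronic K (a + 1) * lowerPronic K a = pronic K a ^ 2 - 2 * pronic K a := by
  simp only [pronic, lowerPronic, Nat.cast_add, Nat.cast_one]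
  ring

/-- The quadratic factors are expanded, and all terms but the two leading ones are moved behind a
power of X, so that comparing coefficients gives a recursion in k. -/
theorem mk_moment_move_eq [CharZero K] {S : Finset ℕ} (hS : 0 ∉ S) {a : ℕ}
    (ha : a ∈ insert 0 S) (ha' : a + 1 ∉ S) :
    mk (moment K (insert (a + 1) (S.erase a))) = mk (moment K S) +
      X * (C (2 * pronic K a + 2) * mk (moment K (insert (a + 1) (S.erase a))) -
        C (2 * pronic K a) * mk (moment K S)) +
      X * (X * (C (pronic K a ^ 2) * mk (moment K S) -
        C (pronic K a ^ 2 - 2 * pronic K a) *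
          mk (moment K (insert (a + 1) (S.erase a))))) := by
  have h := mk_moment_move K hS ha ha'
  rw [← pronic_succ_add_lowerPronic, ← pronic_succ_mul_lowerPronic]
  simp only [map_add, map_mul, map_pow, map_ofNat]
  linear_combination h

end Weights

/-! ### The degree filtration on functions of strict partitions -/

section PolyDeg

open StrictPartition

variable (K : Type*) [Field K]

/-- Functions on strict partitions whose increment under adding a box in row `r` is a polynomial
in `a (a + 1)`, `a = kap_r`, with coefficients that are again functions of this kind; the degree
drops by at least one more than the exponent. -/
inductive PolyDeg : ℕ → (StrictPartition → K) → Prop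
  | intro {n : ℕ} {F : StrictPartition → K} {ι : Type} [Fintype ι] (e m : ι → ℕ)
    (c : ι → StrictPartition → K) (hlt : ∀ i, m i + e i < n) (hc : ∀ i, PolyDeg (m i) (c i))
    (hF : ∀ kap lam r, Step kap lam r →
      F lam - F kap = ∑ i, pronic K (kap.part r) ^ e i * c i kap) : PolyDeg n F

/-- The increments that are allowed in `PolyDeg K n`. -/
def IncrementDeg (n : ℕ) (E : StrictPartition → StrictPartition → ℕ → K) : Prop :=
  ∃ (ι : Type) (_ : Fintype ι) (e m : ι → ℕ) (c : ι → StrictPartition → K),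
    (∀ i, m i + e i < n) ∧ (∀ i, PolyDeg K (m i) (c i)) ∧
      ∀ kap lam r, Step kap lam r → E kap lam r = ∑ i, pronic K (kap.part r) ^ e i * c i kap

variable {K}

theorem polyDeg_iff {n : ℕ} {F : StrictPartition → K} :
    PolyDeg K n F ↔ IncrementDeg K n fun kap lam _ => F lam - F kap := by
  constructor
  · rintro ⟨e, m, c, h1, h2, h3⟩
    exact ⟨_, _, e, m, c, h1, h2, h3⟩
  · rintro ⟨ι, _, e, m, c, h1, h2, h3⟩
    exact ⟨e, m, c, h1, h2, h3⟩

namespace IncrementDeg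

theorem congr {n : ℕ} {E E' : StrictPartition → StrictPartition → ℕ → K}
    (hE : IncrementDeg K n E) (h : ∀ kap lam r, Step kap lam r → E' kap lam r = E kap lam r) :
    IncrementDeg K n E' := by
  obtain ⟨ι, _, e, m, c, h1, h2, h3⟩ := hE
  exact ⟨ι, _, e, m, c, h1, h2, fun kap lam r hs => (h _ _ _ hs).trans (h3 _ _ _ hs)⟩

theorem mono {n n' : ℕ} {E : StrictPartition → StrictPartition → ℕ → K}
    (hE : IncrementDeg K n E) (h : n ≤ n') : IncrementDeg K n' E := by
  obtain ⟨ι, _, e, m, c, h1, h2, h3⟩ := hE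
  exact ⟨ι, _, e, m, c, fun i => (h1 i).trans_le h, h2, h3⟩

theorem add {n : ℕ} {E E' : StrictPartition → StrictPartition → ℕ → K}
    (hE : IncrementDeg K n E) (hE' : IncrementDeg K n E') :
    IncrementDeg K n fun kap lam r => E kap lam r + E' kap lam r := by
  obtain ⟨ι, _, e, m, c, h1, h2, h3⟩ := hE
  obtain ⟨ι', _, e', m', c', h1', h2', h3'⟩ := hE'
  refine ⟨ι ⊕ ι', inferInstance, Sum.elim e e', Sum.elim m m', Sum.elim c c', ?_, ?_, ?_⟩
  · rintro (i | i)
    exacts [h1 i, h1' i]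
  · rintro (i | i)
    exacts [h2 i, h2' i]
  · intro kap lam r hs
    simp only [h3 _ _ _ hs, h3' _ _ _ hs, Fintype.sum_sum_type]
    rfl

theorem pronic_mul {n : ℕ} {E : StrictPartition → StrictPartition → ℕ → K}
    (hE : IncrementDeg K n E) :
    IncrementDeg K (n + 1) fun kap lam r => pronic K (kap.part r) * E kap lam r := by
  obtain ⟨ι, _, e, m, c, h1, h2, h3⟩ := hE
  refine ⟨ι, inferInstance, fun i => e i + 1, m, c, fun i => ?_, h2, fun kap lam r hs => ?_⟩
  · have := h1 i
    simp only
    omega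
  · simp only [h3 _ _ _ hs, Finset.mul_sum]
    exact Finset.sum_congr rfl fun i _ => by ring

theorem of_polyDeg {n m : ℕ} {F : StrictPartition → K} (e : ℕ) (hF : PolyDeg K m F)
    (h : m + e < n) :
    IncrementDeg K n fun kap _ r => pronic K (kap.part r) ^ e * F kap :=
  ⟨Unit, inferInstance, fun _ => e, fun _ => m, fun _ => F, fun _ => h, fun _ => hF,
    fun kap lam r _ => by simp⟩

end IncrementDeg

namespace PolyDeg

theorem mono {n n' : ℕ} {F : StrictPartition → K} (hF : PolyDeg K n F) (h : n ≤ n') :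
    PolyDeg K n' F :=
  polyDeg_iff.2 ((polyDeg_iff.1 hF).mono h)

theorem const (x : K) : PolyDeg K 0 fun _ => x :=
  ⟨(Empty.elim : Empty → ℕ), Empty.elim, Empty.elim, fun i => i.elim, fun i => i.elim,
    fun kap lam r _ => by simp⟩

theorem add {n : ℕ} {F G : StrictPartition → K} (hF : PolyDeg K n F) (hG : PolyDeg K n G) :
    PolyDeg K n fun kap => F kap + G kap :=
  polyDeg_iff.2 (((polyDeg_iff.1 hF).add (polyDeg_iff.1 hG)).congr fun kap lam r _ => by ring)

theorem sum {ι : Type*} (s : Finset ι) {n : ℕ} {F : ι → StrictPartition → K}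
    (hF : ∀ i ∈ s, PolyDeg K n (F i)) : PolyDeg K n fun kap => ∑ i ∈ s, F i kap := by
  classical
  induction s using Finset.induction_on with
  | empty => simpa using (const (0 : K)).mono (Nat.zero_le n)
  | insert i s hi ih =>
    simp only [Finset.sum_insert hi]
    exact (hF i (Finset.mem_insert_self _ _)).add
      (ih fun j hj => hF j (Finset.mem_insert_of_mem hj))

/-- This is the discrete Leibniz rule Δ(FG) = ΔF · G + F · ΔG + ΔF · ΔG, with induction on the total
degree. -/
theorem mul {n m : ℕ} {F G : StrictPartition → K} (hF : PolyDeg K n F) (hG : PolyDeg K m G) :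
    PolyDeg K (n + m) fun kap => F kap * G kap := by
  obtain ⟨N, hN⟩ : ∃ N, n + m = N := ⟨_, rfl⟩
  induction N using Nat.strong_induction_on generalizing n m F G with
  | _ N ih =>
    obtain ⟨ι, _, e, d, c, h1, h2, h3⟩ := polyDeg_iff.1 hF
    obtain ⟨ι', _, e', d', c', h1', h2', h3'⟩ := polyDeg_iff.1 hG
    refine ⟨Sum.elim e (Sum.elim e' fun p : ι × ι' => e p.1 + e' p.2),
      Sum.elim (fun i => d i + m) (Sum.elim (fun j => n + d' j)
        fun p : ι × ι' => d p.1 + d' p.2),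
      Sum.elim (fun i kap => c i kap * G kap) (Sum.elim (fun j kap => F kap * c' j kap)
        fun (p : ι × ι') kap => c p.1 kap * c' p.2 kap), ?_, ?_, ?_⟩
    · rintro (i | j | ⟨i, j⟩)
      · have := h1 i
        simp only [Sum.elim_inl]
        omega
      · have := h1' j
        simp only [Sum.elim_inl, Sum.elim_inr]
        omega
      · have := h1 i
        have := h1' j
        simp only [Sum.elim_inr]
        omega
    · rintro (i | j | ⟨i, j⟩)
      · have := h1 i
        exact ih (d i + m) (by omega) (h2 i) hG rfl
      · have := h1' j
        exact ih (n + d' j) (by omega) hF (h2' j) rfl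
      · have := h1 i
        have := h1' j
        exact ih (d i + d' j) (by omega) (h2 i) (h2' j) rfl
    · intro kap lam r hs
      have e1 : F lam - F kap = _ := h3 kap lam r hs
      have e2 : G lam - G kap = _ := h3' kap lam r hs
      have e3 : F lam * G lam - F kap * G kap = (F lam - F kap) * G kap +
          (F kap * (G lam - G kap) + (F lam - F kap) * (G lam - G kap)) := by ring
      rw [e3, e1, e2, Fintype.sum_sum_type, Fintype.sum_sum_type, Finset.sum_mul, Finset.mul_sum,
        Finset.sum_mul_sum, Fintype.sum_prod_type]
      simp only [Sum.elim_inl, Sum.elim_inr]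
      refine congrArg₂ _ ?_ (congrArg₂ _ ?_ ?_)
      · exact Finset.sum_congr rfl fun i _ => by ring
      · exact Finset.sum_congr rfl fun j _ => by ring
      · exact Finset.sum_congr rfl fun i _ => Finset.sum_congr rfl fun j _ => by ring

theorem const_mul {n : ℕ} {F : StrictPartition → K} (x : K) (hF : PolyDeg K n F) :
    PolyDeg K n fun kap => x * F kap := by
  simpa using (const x).mul hF

end PolyDeg

theorem IncrementDeg.const_mul {n : ℕ} {E : StrictPartition → StrictPartition → ℕ → K} (x : K)
    (hE : IncrementDeg K n E) : IncrementDeg K n fun kap lam r => x * E kap lam r := by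
  obtain ⟨ι, _, e, m, c, h1, h2, h3⟩ := hE
  refine ⟨ι, inferInstance, e, m, fun i kap => x * c i kap, h1, fun i => (h2 i).const_mul x,
    fun kap lam r hs => ?_⟩
  simp only [h3 _ _ _ hs, Finset.mul_sum]
  exact Finset.sum_congr rfl fun i _ => by ring

theorem moment_zero [CharZero K] (kap : StrictPartition) : moment K kap.partSet 0 = 1 := by
  have h := congrArg PowerSeries.constantCoeff (mk_moment_mul_prod K kap.zero_notMem_partSet)
  simpa [map_prod] using h

section MomentStep

variable [CharZero K] {kap lam : StrictPartition} {r : ℕ}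

theorem moment_one_sub (h : Step kap lam r) :
    moment K lam.partSet 1 - moment K kap.partSet 1 = 2 := by
  have h1 := mk_moment_move_eq K kap.zero_notMem_partSet (kap.part_mem_insert r) h.notMem
  rw [← h.partSet_eq] at h1
  have h2 := congrArg (PowerSeries.coeff (0 + 1)) h1
  simp only [map_add (PowerSeries.coeff (0 + 1)), map_sub (PowerSeries.coeff 0),
    PowerSeries.coeff_succ_X_mul, PowerSeries.coeff_zero_X_mul, PowerSeries.coeff_mk,
    PowerSeries.coeff_C_mul, moment_zero] at h2
  linear_combination h2

/-- The new moments are written as old ones plus increments. In this form p(a) m_{k+1} and p(a)²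
m_k, which would exceed the degree bound, have cancelled. -/
theorem moment_add_two_sub (h : Step kap lam r) (k : ℕ) :
    moment K lam.partSet (k + 2) - moment K kap.partSet (k + 2) =
      2 * (pronic K (kap.part r) *
          (moment K lam.partSet (k + 1) - moment K kap.partSet (k + 1))) +
        2 * (moment K lam.partSet (k + 1) - moment K kap.partSet (k + 1)) +
        2 * (pronic K (kap.part r) ^ 0 * moment K kap.partSet (k + 1)) +
        2 * (pronic K (kap.part r) ^ 1 * moment K kap.partSet k) +
        (-1) * (pronic K (kap.part r) * (pronic K (kap.part r) *
          (moment K lam.partSet k - moment K kap.partSet k))) +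
        2 * (pronic K (kap.part r) * (moment K lam.partSet k - moment K kap.partSet k)) := by
  have h1 := mk_moment_move_eq K kap.zero_notMem_partSet (kap.part_mem_insert r) h.notMem
  rw [← h.partSet_eq] at h1
  have h2 := congrArg (PowerSeries.coeff (k + 2)) h1
  simp only [map_add (PowerSeries.coeff (k + 2)), map_sub (PowerSeries.coeff (k + 1)),
    map_sub (PowerSeries.coeff k), PowerSeries.coeff_succ_X_mul, PowerSeries.coeff_mk,
    PowerSeries.coeff_C_mul] at h2
  linear_combination h2

end MomentStep

/-- In the recursion each increment of m_{k+1} carries at most one factor p(a), each increment of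
m_k at most two, and the moments themselves occur only as m_{k+1} and p(a) m_k. All these terms are
admissible in degree k + 2. -/
theorem polyDeg_moment [CharZero K] (k : ℕ) :
    PolyDeg K k fun kap => moment K kap.partSet k := by
  induction k using Nat.strong_induction_on with
  | _ k ih =>
    match k, ih with
    | 0, _ =>
      simp only [moment_zero]
      exact PolyDeg.const 1
    | 1, _ =>
      refine polyDeg_iff.2 ((IncrementDeg.of_polyDeg 0 (PolyDeg.const (2 : K))
        (by omega : 0 + 0 < 1)).congr fun kap lam r h => ?_)
      rw [moment_one_sub h, pow_zero, one_mul]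
    | k + 2, ih =>
      have p1 := ih (k + 1) (by omega)
      have p0 := ih k (by omega)
      have d1 := polyDeg_iff.1 p1
      have d0 := polyDeg_iff.1 p0
      refine polyDeg_iff.2 (IncrementDeg.congr ((((((d1.pronic_mul.const_mul 2).add
        ((d1.mono (by omega)).const_mul 2)).add
        ((IncrementDeg.of_polyDeg 0 p1 (by omega)).const_mul 2)).add
        ((IncrementDeg.of_polyDeg 1 p0 (by omega)).const_mul 2)).add
        (d0.pronic_mul.pronic_mul.const_mul (-1))).add
        ((d0.pronic_mul.mono (by omega)).const_mul 2))
        fun kap lam r h => moment_add_two_sub h k)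

end PolyDeg

/-! ### Transition probabilities and the expected increment -/

section Transition

open StrictPartition

variable {K : Type*} [Field K]

variable (K) in
/-- The weight of the transition from `kap` to `lam`, where `lam` has one box more. -/
noncomputable def transition (kap lam : StrictPartition) : K :=
  (2 : K) ^ (1 - (lam.length : ℤ) + kap.length) * kap.hookProduct / lam.hookProduct

/-- The length grows exactly when a = 0, so the power of 2 is 1 for a new row and 2 otherwise. This
is the factor by which the hook ratio deviates from the Lagrange coefficient. -/
theorem transition_eq_stepWeight [CharZero K] {kap lam : StrictPartition} {r : ℕ}
    (h : Step kap lam r) : transition K kap lam = stepWeight K kap.partSet (kap.part r) := by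
  have h1 := hookValue_move K kap.zero_notMem_partSet (kap.part_mem_insert r) h.notMem
  rw [← h.partSet_eq, ← cast_hookProduct, ← cast_hookProduct] at h1
  have hne : (lam.hookProduct : K) ≠ 0 := Nat.cast_ne_zero.2 lam.hookProduct_pos.ne'
  have h2 : (2 : K) ^ (1 - (lam.length : ℤ) + kap.length) =
      if kap.part r = 0 then 1 else 2 := by
    have hn : kap.part r + 1 ∉ kap.partSet.erase (kap.part r) :=
      fun hm => h.notMem (Finset.mem_of_mem_erase hm)
    have hc := card_partSet lam
    rw [h.partSet_eq, Finset.card_insert_of_notMem hn] at hc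
    split_ifs with h0
    · rw [h0, Finset.erase_eq_of_notMem kap.zero_notMem_partSet, card_partSet] at hc
      rw [show 1 - (lam.length : ℤ) + kap.length = 0 by omega, zpow_zero]
    · have hm : kap.part r ∈ kap.partSet := (kap.mem_partSet _).2 ⟨by omega, r, rfl⟩
      rw [Finset.card_erase_add_one hm, card_partSet] at hc
      rw [show 1 - (lam.length : ℤ) + kap.length = 1 by omega, zpow_one]
  rw [transition, h2, h1, mul_div_assoc, div_self hne, mul_one]

theorem sum_transition_mul [CharZero K] (kap : StrictPartition) (f : StrictPartition → K)
    (g : ℕ → K) (hfg : ∀ lam r, Step kap lam r → f lam = g (kap.part r)) :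
    ∑ lam ∈ kap.skewOfSize 1, transition K kap lam * f lam =
      ∑ a ∈ insert 0 kap.partSet, stepWeight K kap.partSet a * g a := by
  rw [kap.sum_skewOfSize_one _ (fun a => stepWeight K kap.partSet a * g a) fun lam r h => by
    rw [transition_eq_stepWeight h, hfg lam r h]]
  refine Finset.sum_filter_of_ne fun a _ hne h => hne ?_
  rw [stepWeight_eq_zero K h, zero_mul]

theorem sum_transition [CharZero K] (kap : StrictPartition) :
    ∑ lam ∈ kap.skewOfSize 1, transition K kap lam = 1 := by
  have h := sum_transition_mul (K := K) kap (fun _ => 1) (fun _ => 1) fun _ _ _ => rfl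
  rw [← moment_zero (K := K) kap, moment]
  simpa using h

/-- The expected increment of `F` under adding a box. -/
noncomputable def expectedIncrement (F : StrictPartition → K) (kap : StrictPartition) : K :=
  ∑ lam ∈ kap.skewOfSize 1, transition K kap lam * (F lam - F kap)

theorem expectedIncrement_eq [CharZero K] {ι : Type} [Fintype ι] (e : ι → ℕ)
    (c : ι → StrictPartition → K) (F : StrictPartition → K)
    (hF : ∀ kap lam r, Step kap lam r →
      F lam - F kap = ∑ i, pronic K (kap.part r) ^ e i * c i kap) (kap : StrictPartition) :
    expectedIncrement F kap = ∑ i, c i kap * moment K kap.partSet (e i) := by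
  rw [expectedIncrement, sum_transition_mul kap _
    (fun a => ∑ i, pronic K a ^ e i * c i kap) fun lam r h => hF kap lam r h]
  simp only [Finset.mul_sum, moment]
  rw [Finset.sum_comm]
  exact Finset.sum_congr rfl fun i _ => Finset.sum_congr rfl fun a _ => by ring

theorem PolyDeg.expectedIncrement_eq_zero [CharZero K] {F : StrictPartition → K}
    (hF : PolyDeg K 0 F) : expectedIncrement F = 0 := by
  obtain ⟨ι, _, e, m, c, h1, h2, h3⟩ := polyDeg_iff.1 hF
  funext kap
  rw [_root_.expectedIncrement_eq e c F h3]
  exact Finset.sum_eq_zero fun i _ => absurd (h1 i) (Nat.not_lt_zero _)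

/-- Averaging turns a term p(a)^e c(κ) of the increment into m_e(κ) c(κ), of degree at most e + deg
c, which is less than n + 1. -/
theorem PolyDeg.expectedIncrement [CharZero K] {n : ℕ} {F : StrictPartition → K}
    (hF : PolyDeg K (n + 1) F) : PolyDeg K n (expectedIncrement F) := by
  obtain ⟨ι, _, e, m, c, h1, h2, h3⟩ := polyDeg_iff.1 hF
  rw [funext (_root_.expectedIncrement_eq e c F h3)]
  refine PolyDeg.sum _ fun i _ => ((h2 i).mul (polyDeg_moment (e i))).mono ?_
  have := h1 i
  omega

end Transition

/-! ### Expanding a symmetric function in one variable -/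

namespace IsSymmetricFunction

/-- Exponent vectors, split into the exponent of the first variable and the others. -/
noncomputable def consEquiv : ℕ × (ℕ →₀ ℕ) ≃ (ℕ →₀ ℕ) where
  toFun p := Finsupp.single 0 p.1 + p.2.mapDomain Nat.succ
  invFun m := (m 0, m.comapDomain Nat.succ Nat.succ_injective.injOn)
  left_inv p := by
    refine Prod.ext ?_ (Finsupp.ext fun i => ?_)
    · simp [Finsupp.mapDomain_of_notMem_range]
    · simp [Finsupp.mapDomain_apply Nat.succ_injective]
  right_inv m := by
    ext i
    cases i with
    | zero => simp [Finsupp.mapDomain_of_notMem_range]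
    | succ i =>
      have := Finsupp.mapDomain_apply Nat.succ_injective
        (m.comapDomain Nat.succ Nat.succ_injective.injOn) i
      simpa using this

theorem consEquiv_zero (p : ℕ × (ℕ →₀ ℕ)) : consEquiv p 0 = p.1 :=
  congrArg Prod.fst (consEquiv.symm_apply_apply p)

theorem consEquiv_succ (p : ℕ × (ℕ →₀ ℕ)) (i : ℕ) : consEquiv p (i + 1) = p.2 i :=
  DFunLike.congr_fun (congrArg Prod.snd (consEquiv.symm_apply_apply p)) i

theorem degree_consEquiv (p : ℕ × (ℕ →₀ ℕ)) : (consEquiv p).degree = p.1 + p.2.degree := by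
  change (Finsupp.single 0 p.1 + p.2.mapDomain Nat.succ).degree = _
  rw [map_add, Finsupp.degree_mapDomain, Finsupp.degree_single]

theorem prod_consEquiv {K : Type*} [CommSemiring K] (p : ℕ × (ℕ →₀ ℕ)) (a : ℕ → K) :
    ((consEquiv p).prod fun i e => a i ^ e) =
      a 0 ^ p.1 * p.2.prod fun i e => a (i + 1) ^ e := by
  change (Finsupp.single 0 p.1 + p.2.mapDomain Nat.succ).prod _ = _
  rw [Finsupp.prod_add_index' (fun i => pow_zero (a i)) (fun i => pow_add (a i)),
    Finsupp.prod_single_index (h := fun i e => a i ^ e) (pow_zero (a 0)),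
    Finsupp.prod_mapDomain_index (h := fun i e => a i ^ e) (fun i => pow_zero (a i))
      (fun i => pow_add (a i))]

/-- The permutation that fixes `0` and acts on the other numbers as `σ`, shifted. -/
def shiftPerm (σ : Equiv.Perm ℕ) : Equiv.Perm ℕ where
  toFun i := Nat.casesOn i 0 fun i => σ i + 1
  invFun i := Nat.casesOn i 0 fun i => σ.symm i + 1
  left_inv i := by cases i <;> simp
  right_inv i := by cases i <;> simp

variable {K : Type*} [Field K]

/-- The coefficient of `x_0 ^ k` in `Q`, as a power series in the other variables, which are
renumbered from `0`. -/
noncomputable def slice (Q : MvPowerSeries ℕ K) (k : ℕ) : MvPowerSeries ℕ K :=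
  fun m => MvPowerSeries.coeff (consEquiv (k, m)) Q

theorem coeff_slice (Q : MvPowerSeries ℕ K) (k : ℕ) (m : ℕ →₀ ℕ) :
    MvPowerSeries.coeff m (slice Q k) = MvPowerSeries.coeff (consEquiv (k, m)) Q := rfl

theorem coeff_slice_eq_zero {Q : MvPowerSeries ℕ K} {d : ℕ}
    (hd : ∀ m : ℕ →₀ ℕ, d < m.degree → MvPowerSeries.coeff m Q = 0) {k : ℕ} {m : ℕ →₀ ℕ}
    (h : d < k + m.degree) : MvPowerSeries.coeff m (slice Q k) = 0 := by
  rw [coeff_slice, hd _ (by rwa [degree_consEquiv])]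

theorem slice_isSymmetricFunction {Q : MvPowerSeries ℕ K} (hQ : IsSymmetricFunction Q) (k : ℕ) :
    IsSymmetricFunction (slice Q k) where
  bounded := by
    obtain ⟨d, hd⟩ := hQ.bounded
    exact ⟨d, fun m hm => coeff_slice_eq_zero hd (by omega)⟩
  symm σ m := by
    rw [coeff_slice, coeff_slice, ← hQ.symm (shiftPerm σ) (consEquiv (k, m))]
    refine congrArg (fun m => MvPowerSeries.coeff m Q) (Finsupp.ext fun i => ?_)
    rw [Finsupp.equivMapDomain_apply]
    cases i with
    | zero =>
      change _ = consEquiv (k, m) 0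
      rw [consEquiv_zero, consEquiv_zero]
    | succ i =>
      change _ = consEquiv (k, m) (σ.symm i + 1)
      rw [consEquiv_succ, consEquiv_succ, Finsupp.equivMapDomain_apply]

theorem evalSeq_eq_sum_slice {Q : MvPowerSeries ℕ K} (hQ : IsSymmetricFunction Q) {d : ℕ}
    (hd : ∀ m : ℕ →₀ ℕ, d < m.degree → MvPowerSeries.coeff m Q = 0) (a : ℕ → K)
    (ha : (Function.support a).Finite) :
    evalSeq Q a =
      ∑ k ∈ Finset.range (d + 1), a 0 ^ k * evalSeq (slice Q k) fun i => a (i + 1) := by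
  have hfin := hQ.finite_support_term a ha
  have hterm : ∀ p : ℕ × (ℕ →₀ ℕ), MvPowerSeries.coeff (consEquiv p) Q *
      ((consEquiv p).prod fun i e => a i ^ e) =
      a 0 ^ p.1 * (MvPowerSeries.coeff p.2 (slice Q p.1) *
        p.2.prod fun i e => a (i + 1) ^ e) := by
    intro p
    rw [prod_consEquiv, coeff_slice]
    ring
  have hfin' : (Function.support fun p : ℕ × (ℕ →₀ ℕ) =>
      a 0 ^ p.1 * (MvPowerSeries.coeff p.2 (slice Q p.1) *
        p.2.prod fun i e => a (i + 1) ^ e)).Finite := by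
    refine (hfin.preimage (f := consEquiv) consEquiv.injective.injOn).subset fun p hp => ?_
    rw [Set.mem_preimage, Function.mem_support, hterm]
    exact hp
  rw [evalSeq, ← finsum_comp_equiv consEquiv]
  simp only [hterm]
  rw [finsum_curry _ hfin']
  have hinner : ∀ k, (∑ᶠ m : ℕ →₀ ℕ, a 0 ^ k * (MvPowerSeries.coeff m (slice Q k) *
      m.prod fun i e => a (i + 1) ^ e)) = a 0 ^ k * evalSeq (slice Q k) fun i => a (i + 1) :=
    fun k => (mul_finsum _ _).symm
  simp only [hinner]
  refine finsum_eq_sum_of_support_subset _ fun k hk => ?_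
  rw [Finset.coe_range, Set.mem_Iio]
  by_contra hlt
  refine hk ?_
  have : evalSeq (slice Q k) (fun i => a (i + 1)) = 0 := by
    rw [evalSeq]
    refine finsum_eq_zero_of_forall_eq_zero fun m => ?_
    rw [coeff_slice_eq_zero hd (by omega), zero_mul]
  simp only [this, mul_zero]

variable {ι : Type*}

/-- The sequence at which `evalOn` evaluates. -/
noncomputable def valueSeq (s : Finset ι) (v : ι → K) (i : ℕ) : K :=
  if h : i < s.card then v (s.equivFin.symm ⟨i, h⟩) else 0

theorem evalOn_eq_valueSeq (Q : MvPowerSeries ℕ K) (s : Finset ι) (v : ι → K) :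
    evalOn Q s v = evalSeq Q (valueSeq s v) := rfl

theorem finite_support_cons_valueSeq (s : Finset ι) (v : ι → K) (x : K) :
    (Function.support fun i => Nat.casesOn (motive := fun _ => K) i x (valueSeq s v)).Finite := by
  refine (Set.finite_lt_nat (s.card + 1)).subset fun i hi => ?_
  cases i with
  | zero => exact Nat.succ_pos _
  | succ i =>
    by_contra h
    exact hi (dif_neg fun h' => h (Nat.succ_lt_succ h'))

/-- By symmetry the first variable can be reserved for the value 0. The evaluations before and after
adding a box then differ in that variable only. -/
theorem evalOn_eq_evalSeq_cons {Q : MvPowerSeries ℕ K} (hQ : IsSymmetricFunction Q)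
    (s : Finset ι) (v : ι → K) :
    evalOn Q s v =
      evalSeq Q fun i => Nat.casesOn (motive := fun _ => K) i 0 (valueSeq s v) := by
  let e : {b // b ∈ s} ↪ ℕ := ⟨fun b => (s.equivFin b : ℕ) + 1, fun b c h =>
    s.equivFin.injective (Fin.ext (Nat.succ_injective h))⟩
  rw [evalOn_eq hQ s v e]
  congr 1
  funext i
  cases i with
  | zero =>
    rw [Function.extend_apply']
    · rfl
    · rintro ⟨b, hb⟩
      exact Nat.succ_ne_zero _ hb
  | succ i =>
    simp only [valueSeq]
    split_ifs with h
    · have hi : e (s.equivFin.symm ⟨i, h⟩) = i + 1 := by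
        change (s.equivFin (s.equivFin.symm ⟨i, h⟩) : ℕ) + 1 = i + 1
        rw [Equiv.apply_symm_apply]
      rw [← hi, e.injective.extend_apply]
    · rw [Function.extend_apply']
      · rfl
      · rintro ⟨b, hb⟩
        exact h (Nat.succ_injective hb ▸ (s.equivFin b).2)

theorem evalOn_insert_eq_evalSeq_cons [DecidableEq ι] {Q : MvPowerSeries ℕ K}
    (hQ : IsSymmetricFunction Q) {s : Finset ι} (v : ι → K) {b : ι} (hb : b ∉ s) :
    evalOn Q (insert b s) v =
      evalSeq Q fun i => Nat.casesOn (motive := fun _ => K) i (v b) (valueSeq s v) := by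
  have hmem : ∀ c : {c // c ∈ insert b s}, c.1 ≠ b → c.1 ∈ s := fun c h =>
    (Finset.mem_insert.1 c.2).resolve_left h
  let e : {c // c ∈ insert b s} ↪ ℕ :=
    ⟨fun c => if h : c.1 = b then 0 else (s.equivFin ⟨c.1, hmem c h⟩ : ℕ) + 1, by
      intro c c' h
      by_cases h1 : c.1 = b <;> by_cases h2 : c'.1 = b
      · exact Subtype.ext (h1.trans h2.symm)
      · simp [h1, h2] at h
      · simp [h1, h2] at h
      · simp only [h1, h2, dite_false, Nat.add_right_cancel_iff] at h
        have := congrArg Subtype.val (s.equivFin.injective (Fin.ext h))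
        exact Subtype.ext this⟩
  have he0 : ∀ c, c.1 = b → e c = 0 := fun c h => dif_pos h
  have he1 : ∀ c (h : c.1 ≠ b), e c = (s.equivFin ⟨c.1, hmem c h⟩ : ℕ) + 1 := fun c h => dif_neg h
  rw [evalOn_eq hQ _ v e]
  congr 1
  funext i
  cases i with
  | zero =>
    have hi : e ⟨b, Finset.mem_insert_self b s⟩ = 0 := he0 _ rfl
    rw [← hi, e.injective.extend_apply]
    simp [hi]
  | succ i =>
    simp only [valueSeq]
    split_ifs with h
    · have hne : (s.equivFin.symm ⟨i, h⟩ : ι) ≠ b := fun he => hb (he ▸ Subtype.prop _)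
      have hi : e ⟨s.equivFin.symm ⟨i, h⟩, Finset.mem_insert_of_mem (Subtype.prop _)⟩ =
          i + 1 := by
        rw [he1 _ hne, Subtype.coe_eta, Equiv.apply_symm_apply]
      rw [← hi, e.injective.extend_apply]
    · rw [Function.extend_apply']
      · rfl
      · rintro ⟨c, hc⟩
        by_cases h1 : c.1 = b
        · rw [he0 c h1] at hc
          exact Nat.succ_ne_zero i hc.symm
        · rw [he1 c h1] at hc
          exact h (Nat.succ_injective hc ▸ (s.equivFin _).2)

/-- Both values are expanded in powers of the first variable, which is `v b` and 0 respectively. The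
constant terms cancel. -/
theorem evalOn_insert_sub [DecidableEq ι] {Q : MvPowerSeries ℕ K} (hQ : IsSymmetricFunction Q)
    {d : ℕ} (hd : ∀ m : ℕ →₀ ℕ, d < m.degree → MvPowerSeries.coeff m Q = 0) {s : Finset ι}
    (v : ι → K) {b : ι} (hb : b ∉ s) :
    evalOn Q (insert b s) v - evalOn Q s v =
      ∑ k ∈ Finset.range d, v b ^ (k + 1) * evalOn (slice Q (k + 1)) s v := by
  rw [evalOn_insert_eq_evalSeq_cons hQ v hb, evalOn_eq_evalSeq_cons hQ s v,
    evalSeq_eq_sum_slice hQ hd _ (finite_support_cons_valueSeq s v _),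
    evalSeq_eq_sum_slice hQ hd _ (finite_support_cons_valueSeq s v _),
    Finset.sum_range_succ', Finset.sum_range_succ' _ d]
  simp [evalOn_eq_valueSeq]

/-- The coefficient of the (k+1)-st power has degree at most d - (k + 1) as a symmetric function. By
induction its term is admissible, since 2(d - k - 1) + (k + 1) < 2d. -/
theorem polyDeg_evalOn [CharZero K] {Q : MvPowerSeries ℕ K} (hQ : IsSymmetricFunction Q) {d : ℕ}
    (hd : ∀ m : ℕ →₀ ℕ, d < m.degree → MvPowerSeries.coeff m Q = 0) :
    PolyDeg K (2 * d) fun lam => evalOn Q lam.cells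
      fun b => ((StrictPartition.content b).choose 2 : K) := by
  induction d using Nat.strong_induction_on generalizing Q with
  | _ d ih =>
    refine ⟨fun k : Fin d => (k : ℕ) + 1, fun k => 2 * (d - (k + 1)),
      fun k lam => (1 / 2 : K) ^ ((k : ℕ) + 1) * evalOn (slice Q (k + 1)) lam.cells
        fun b => ((StrictPartition.content b).choose 2 : K), ?_, ?_, ?_⟩
    · intro k
      have := k.2
      omega
    · intro k
      have := k.2
      exact (ih _ (by omega) (slice_isSymmetricFunction hQ _)
        fun m hm => coeff_slice_eq_zero hd (by omega)).const_mul _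
    · intro kap lam r h
      rw [h.cells_eq, evalOn_insert_sub hQ hd _ h.notMem_cells, Finset.sum_range]
      refine Finset.sum_congr rfl fun k _ => ?_
      have hc : StrictPartition.content (r, r + kap.part r + 1) = kap.part r + 1 := by
        rw [StrictPartition.content]
        omega
      have hv : (((kap.part r + 1).choose 2 : ℕ) : K) = pronic K (kap.part r) * (1 / 2) := by
        rw [Nat.cast_choose_two, pronic, Nat.cast_add, Nat.cast_one]
        ring
      rw [hc, hv, mul_pow, mul_assoc]

end IsSymmetricFunction

/-! ### Weighted sums and their finite differences -/

section WeightedSum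

open StrictPartition

variable {K : Type*} [Field K]

/-- The sum of `φ` over all `lam ⊇ mu` with `|lam/mu| = n`, weighted by the tableaux of shape
`lam/mu` and a power of two. -/
noncomputable def weightedSum (mu : StrictPartition) (φ : StrictPartition → K) (n : ℕ) : K :=
  ∑ lam ∈ mu.skewOfSize n,
    (2 : K) ^ ((lam.size : ℤ) - mu.size - lam.length + mu.length) * (lam.numTableaux mu : K) * φ lam

/-- The branching rule is inserted and the sums over λ and κ are exchanged; the exponent of 2 is
additive along μ ⊆ κ ⊆ λ. -/
theorem weightedSum_succ [CharZero K] (mu : StrictPartition) (φ : StrictPartition → K) (n : ℕ) :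
    weightedSum mu φ (n + 1) = weightedSum mu (fun kap => ∑ lam ∈ kap.skewOfSize 1,
      (2 : K) ^ (1 - (lam.length : ℤ) + kap.length) * φ lam) n := by
  classical
  have h1 : weightedSum mu φ (n + 1) = ∑ lam ∈ mu.skewOfSize (n + 1),
      ∑ kap ∈ mu.skewOfSize n with lam ∈ kap.skewOfSize 1,
        (2 : K) ^ ((lam.size : ℤ) - mu.size - lam.length + mu.length) *
          (kap.numTableaux mu : K) * φ lam := by
    refine Finset.sum_congr rfl fun lam h => ?_
    rw [numTableaux_succ h, Nat.cast_sum, Finset.mul_sum, Finset.sum_mul]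
  rw [h1, weightedSum, Finset.sum_comm' (t' := mu.skewOfSize n) (s' := fun kap => kap.skewOfSize 1)]
  · refine Finset.sum_congr rfl fun kap _ => ?_
    rw [Finset.mul_sum]
    refine Finset.sum_congr rfl fun lam h => ?_
    rw [mem_skewOfSize] at h
    rw [show (lam.size : ℤ) - mu.size - lam.length + mu.length =
      ((kap.size : ℤ) - mu.size - kap.length + mu.length) +
        (1 - (lam.length : ℤ) + kap.length) by rw [h.2]; push_cast; ring,
      zpow_add₀ two_ne_zero]
    ring
  · intro lam kap
    rw [Finset.mem_filter]
    constructor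
    · rintro ⟨-, h2, h3⟩
      exact ⟨h3, h2⟩
    · rintro ⟨h3, h2⟩
      refine ⟨?_, h2, h3⟩
      rw [mem_skewOfSize] at h2 h3 ⊢
      exact ⟨h3.1.trans h2.1, by omega⟩

/-- Because the transition weights sum to 1, the average of `F` over the one-box extensions of κ is
`F kap` plus the expected increment. -/
theorem weightedSum_div_hookProduct_succ [CharZero K] (mu : StrictPartition)
    (F : StrictPartition → K) (n : ℕ) :
    weightedSum mu (fun lam => F lam / lam.hookProduct) (n + 1) =
      weightedSum mu (fun lam => F lam / lam.hookProduct) n +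
        weightedSum mu (fun lam => expectedIncrement F lam / lam.hookProduct) n := by
  rw [weightedSum_succ, weightedSum, weightedSum, weightedSum, ← Finset.sum_add_distrib]
  refine Finset.sum_congr rfl fun kap _ => ?_
  rw [← mul_add]
  congr 1
  have hne : (kap.hookProduct : K) ≠ 0 := Nat.cast_ne_zero.2 kap.hookProduct_pos.ne'
  have h1 : F kap + expectedIncrement F kap =
      ∑ lam ∈ kap.skewOfSize 1, transition K kap lam * F lam := by
    simp only [expectedIncrement, mul_sub, Finset.sum_sub_distrib]
    rw [← Finset.sum_mul, sum_transition]
    ring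
  rw [← add_div, h1, eq_div_iff hne, Finset.sum_mul]
  refine Finset.sum_congr rfl fun lam _ => ?_
  rw [transition]
  ring

theorem exists_eq_sum_choose_of_sub {d : ℕ} {g g' : ℕ → K} (h : ∀ n, g (n + 1) = g n + g' n)
    (hg' : ∃ c : ℕ → K, ∀ n, g' n = ∑ k ∈ Finset.range d, c k * (n.choose k : K)) :
    ∃ c : ℕ → K, ∀ n, g n = ∑ k ∈ Finset.range (d + 1), c k * (n.choose k : K) := by
  obtain ⟨c, hc⟩ := hg'
  -- By Pascal's rule binom(n, k+1) has difference binom(n, k), so summation shifts the coefficients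
  -- by one and g(0) becomes the constant term.
  refine ⟨fun k => Nat.casesOn k (g 0) c, fun n => ?_⟩
  rw [Finset.sum_range_succ']
  induction n with
  | zero => simp
  | succ n ih =>
    rw [h, ih, hc]
    simp only [Nat.choose_succ_succ, Nat.cast_add, mul_add, Finset.sum_add_distrib,
      Nat.choose_zero_right]
    ring

theorem PolyDeg.weightedSum_eq_sum_choose [CharZero K] (mu : StrictPartition) {d : ℕ}
    {F : StrictPartition → K} (hF : PolyDeg K d F) :
    ∃ c : ℕ → K, ∀ n, weightedSum mu (fun lam => F lam / lam.hookProduct) n =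
      ∑ k ∈ Finset.range (d + 1), c k * (n.choose k : K) := by
  induction d generalizing F with
  | zero =>
    refine exists_eq_sum_choose_of_sub (weightedSum_div_hookProduct_succ mu F)
      ⟨0, fun n => ?_⟩
    -- In degree 0 the expected increment vanishes, so the weighted sum is constant in n.
    simp [hF.expectedIncrement_eq_zero, weightedSum]
  | succ d ih =>
    exact exists_eq_sum_choose_of_sub (weightedSum_div_hookProduct_succ mu F)
      (ih hF.expectedIncrement)

theorem cast_choose_eq_eval [CharZero K] (n k : ℕ) :
    (n.choose k : K) =
      (Polynomial.C ((k.factorial : K)⁻¹) * descPochhammer K k).eval (n : K) := by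
  have hne : (k.factorial : K) ≠ 0 := Nat.cast_ne_zero.2 k.factorial_ne_zero
  rw [Polynomial.eval_mul, Polynomial.eval_C, descPochhammer_eval_eq_descFactorial,
    Nat.descFactorial_eq_factorial_mul_choose, Nat.cast_mul, inv_mul_cancel_left₀ hne]

end WeightedSum

theorem mainTheorem2 {K : Type*} [Field K] [CharZero K] (Q : MvPowerSeries ℕ K)
    (hQ : IsSymmetricFunction Q) (mu : StrictPartition) :
    ∃ P : Polynomial K, ∀ n : ℕ,
      ∑ lam ∈ mu.skewOfSize n,
        (2 : K) ^ ((lam.size : ℤ) - mu.size - lam.length + mu.length) *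
            (lam.numTableaux mu : K) / (lam.hookProduct : K) *
          IsSymmetricFunction.evalOn Q lam.cells
            (fun b => ((StrictPartition.content b).choose 2 : K))
      = P.eval (n : K) := by
  obtain ⟨d, hd⟩ := hQ.bounded
  obtain ⟨c, hc⟩ :=
    (IsSymmetricFunction.polyDeg_evalOn hQ hd).weightedSum_eq_sum_choose mu
  refine ⟨∑ k ∈ Finset.range (2 * d + 1), Polynomial.C (c k) *
    (Polynomial.C ((k.factorial : K)⁻¹) * descPochhammer K k), fun n => ?_⟩
  rw [Polynomial.eval_finsetSum]
  simp only [Polynomial.eval_mul (p := Polynomial.C (c _)), Polynomial.eval_C,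
    ← cast_choose_eq_eval]
  rw [← hc, weightedSum]
  exact Finset.sum_congr rfl fun lam _ => by ring
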